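/- Let $G=(V,E)$ be a finite connected simple graph. Let $\overrightarrow{E}$ be the set of ordered pairs $(u,v)$ with $uv\in E$, and let $\varphi:\overrightarrow{E}\to\{z\in\mathbb{C}:|z|=1\}$ satisfy $\varphi(u,v)=\varphi(v,u)^{-1}$ for every $(u,v)\in\overrightarrow{E}$ (so $(G,\varphi)$ is a connected complex unit gain graph). Let $r(G,\varphi)$ be the rank of the Hermitian matrix $H(G,\varphi)$ indexed by $V$ whose $(u,v)$ entry is $\varphi(u,v)$ if $uv\in E$ and $0$ otherwise. For a graph $F$ let $m(F)$ be its matching number, the maximum number of edges in a matching. Let $c(G)=|E|-|V|+\omega(G)$ be the cyclomatic number, where $\omega(G)$ is the number of connected components of $G$. For a cycle $C_l=v_1v_2\cdots v_lv_1$ of length $l$ put $\varphi(C_l)=\varphi(v_1,v_2)\varphi(v_2,v_3)\cdots\varphi(v_{l-1},v_l)\varphi(v_l,v_1)$; its real part depends neither on the starting vertex nor on the direction. Let $O(G)$ be the set of vertices that lie on cycles of $G$, let $G-O(G)$ be the graph obtained by deleting these vertices, and let $T_G$ be the simple graph obtained from $G$ by contracting each cycle of $G$ to a single vertex. Then $r(G,\varphi)=2m(G)+c(G)$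 if and only if all of the following conditions hold: (i) the cycles (if any) of $G$ are pairwise vertex-disjoint; (ii) for each cycle (if any) $C_l$ of $G$, $\operatorname{Re}(\varphi(C_l))\neq 0$ and $l$ is odd; (iii) $m(T_G)=m(G-O(G))$. -/

import Mathlib

/-- A complex unit gain function on `G`: each oriented edge gets a unit complex number, and
reversing the orientation inverts it. -/
structure UnitGain {V : Type*} (G : SimpleGraph V) where
  /-- the gain of an oriented edge -/
  gain : G.Dart → Circle
  gain_symm : ∀ d : G.Dart, gain d.symm = (gain d)⁻¹

namespace UnitGain

variable {V : Type*} {G : SimpleGraph V}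

open Classical in
/-- The Hermitian adjacency matrix `H(G, φ)`. -/
noncomputable def adjMatrix (φ : UnitGain G) : Matrix V V ℂ :=
  Matrix.of fun u v => if h : G.Adj u v then (φ.gain ⟨(u, v), h⟩ : ℂ) else 0

/-- The rank `r(G, φ)`. -/
noncomputable def rank [Fintype V] (φ : UnitGain G) : ℕ :=
  φ.adjMatrix.rank

/-- The gain `φ(v₁v₂)φ(v₂v₃)⋯` of a walk: the product of the gains of its oriented edges. -/
noncomputable def walkGain (φ : UnitGain G) {u v : V} (w : G.Walk u v) : Circle :=
  (w.darts.map φ.gain).prod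

end UnitGain

namespace GainGraph

variable {V : Type*}

/-- The matching number `m(G)`: the largest number of edges of a matching (for finite graphs). -/
noncomputable def matchingNumber (G : SimpleGraph V) : ℕ :=
  sSup {n : ℕ | ∃ M : G.Subgraph, M.IsMatching ∧ M.edgeSet.ncard = n}

/-- The cyclomatic number `c(G) = |E(G)| - |V(G)| + ω(G)` of a finite graph, as an integer. -/
noncomputable def cyclomaticNumber (G : SimpleGraph V) : ℤ :=
  (Nat.card G.edgeSet : ℤ) - Nat.card V + Nat.card G.ConnectedComponent

/-- The cycles of `G`, as subgraphs: neither starting point nor direction matters. -/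
def cycleSubgraphs (G : SimpleGraph V) : Set G.Subgraph :=
  {C | ∃ (u : V) (w : G.Walk u u), w.IsCycle ∧ C = w.toSubgraph}

/-- `O(G)`: the set of vertices that lie on cycles of `G`. -/
def cycleVertices (G : SimpleGraph V) : Set V :=
  ⋃ C ∈ cycleSubgraphs G, C.verts

/-- The equivalence relation generated by lying on a common cycle. -/
def cycleSetoid (G : SimpleGraph V) : Setoid V :=
  Relation.EqvGen.setoid fun u v => ∃ C ∈ cycleSubgraphs G, u ∈ C.verts ∧ v ∈ C.verts

/-- `T_G`: the simple graph obtained from `G` by contracting each cycle to one vertex. Two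
distinct classes are adjacent iff some edge of `G` joins them. -/
def contractCycles (G : SimpleGraph V) : SimpleGraph (Quotient (cycleSetoid G)) :=
  G.map (Quotient.mk (cycleSetoid G))

end GainGraph

/-! The rank of a Hermitian matrix is the order of a nonzero principal minor, on some vertex set S
(`exists_principal_minor`). A nonzero term of its expansion is a permutation with support S that
moves along edges. Its orbits of length two are edges, the longer ones run around cycles of G. An
orbit of length k contains ⌊k/2⌋ disjoint edges, so |S| ≤ 2m(G) + (number of odd orbits). The odd
orbits are disjoint cycles, and there are at most c(G) disjoint cycles: this bounds the rank.

In case of equality there are exactly c(G) odd orbits. Deleting one edge from each leaves a tree, so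
they are all the cycles of G (`exists_eq_of_card_eq`); hence the cycles are disjoint and odd. This
holds for every nonzero term, so entries joining a cycle to anything outside it can be erased
without changing the minor (`det_cycleBlockMatrix`). The block of a cycle C has determinant ±2 Re
φ(C), which must be nonzero (`det_cycle_ne_zero_iff`). Condition (iii) follows by counting: a
matching of T_G extends by near-perfect matchings of the odd cycles, while S outside O(G) is matched
within G - O(G).

Conversely, let S consist of O(G) and the vertices of a maximum matching of G - O(G). Under (iii),
König's theorem for the forest T_G gives |S| ≥ 2m(G) + c(G) (`matchingNumber_le_of_eq`), so the
minor again splits into blocks. The matched block is nonsingular because its nonzero terms are all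
equal (`det_matched_ne_zero`). -/

namespace GainGraph

/-! ### Matchings as indexed families; König's theorem for forests -/

/-- A matching of `G` given as a family of pairwise vertex-disjoint edges. -/
def IsEdgeMatching {V ι : Type*} (G : SimpleGraph V) (e : ι → Sym2 V) : Prop :=
  (∀ i, e i ∈ G.edgeSet) ∧ ∀ ⦃i j x⦄, x ∈ e i → x ∈ e j → i = j

theorem IsEdgeMatching.injective {V ι : Type*} {G : SimpleGraph V} {e : ι → Sym2 V}
    (he : IsEdgeMatching G e) : Function.Injective e := by
  intro i j h
  have hx : (e i).out.1 ∈ e i := Sym2.out_fst_mem _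
  exact he.2 hx (h ▸ hx)

theorem bddAbove_matching {V : Type*} [Finite V] (G : SimpleGraph V) :
    BddAbove {n : ℕ | ∃ M : G.Subgraph, M.IsMatching ∧ M.edgeSet.ncard = n} := by
  refine ⟨G.edgeSet.ncard, ?_⟩
  rintro n ⟨M, -, rfl⟩
  exact Set.ncard_le_ncard M.edgeSet_subset (Set.toFinite _)

/-- An arbitrary finite index type lets matchings be glued over `Option`, sums and sigma types. -/
theorem IsEdgeMatching.card_le {V ι : Type*} [Finite V] [Fintype ι] {G : SimpleGraph V}
    {e : ι → Sym2 V} (he : IsEdgeMatching G e) : Fintype.card ι ≤ matchingNumber G := by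
  let M : G.Subgraph :=
    { verts := {x | ∃ i, x ∈ e i}
      Adj := fun x y => ∃ i, e i = s(x, y)
      adj_sub := by
        rintro x y ⟨i, hi⟩
        have := he.1 i
        rwa [hi, SimpleGraph.mem_edgeSet] at this
      edge_vert := by
        rintro x y ⟨i, hi⟩
        exact ⟨i, by simp [hi]⟩
      symm := ⟨by
        rintro x y ⟨i, hi⟩
        exact ⟨i, by rw [hi, Sym2.eq_swap]⟩⟩ }
  have hM : M.IsMatching := by
    rintro x ⟨i, hi⟩
    obtain ⟨y, hy⟩ := Sym2.mem_iff_exists.1 hi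
    refine ⟨y, ⟨i, hy⟩, ?_⟩
    rintro z ⟨j, hj⟩
    have : i = j := he.2 hi (by simp [hj])
    subst this
    rw [hy] at hj
    exact (Sym2.congr_right.1 hj).symm
  have hE : M.edgeSet = Set.range e := by
    ext z
    induction z with | _ x y => ?_
    rfl
  refine le_csSup (bddAbove_matching G) ⟨M, hM, ?_⟩
  rw [hE, ← Set.image_univ, Set.ncard_image_of_injective _ he.injective, Set.ncard_univ,
    Nat.card_eq_fintype_card]

theorem exists_isEdgeMatching {V : Type*} [Finite V] (G : SimpleGraph V) :
    ∃ e : Fin (matchingNumber G) → Sym2 V, IsEdgeMatching G e := by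
  obtain ⟨M, hM, hn⟩ : matchingNumber G ∈
      {n : ℕ | ∃ M : G.Subgraph, M.IsMatching ∧ M.edgeSet.ncard = n} :=
    Nat.sSup_mem ⟨0, ⊥, by simp [SimpleGraph.Subgraph.IsMatching], by simp⟩ (bddAbove_matching G)
  have hcard : Nat.card M.edgeSet = matchingNumber G := hn
  have : Finite M.edgeSet := Set.toFinite _
  let f := (Finite.equivFinOfCardEq hcard).symm
  refine ⟨fun i => (f i : Sym2 V), fun i => M.edgeSet_subset (f i).2, ?_⟩
  intro i j x hi hj
  change x ∈ (f i : Sym2 V) at hi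
  change x ∈ (f j : Sym2 V) at hj
  obtain ⟨y, hy⟩ := Sym2.mem_iff_exists.1 hi
  obtain ⟨z, hz⟩ := Sym2.mem_iff_exists.1 hj
  have h1 : M.Adj x y := by
    have := (f i).2
    rwa [hy, SimpleGraph.Subgraph.mem_edgeSet] at this
  have h2 : M.Adj x z := by
    have := (f j).2
    rwa [hz, SimpleGraph.Subgraph.mem_edgeSet] at this
  have : y = z := (hM (M.edge_vert h1)).unique h1 h2
  exact f.injective (Subtype.ext (by rw [hy, hz, this]))

/-- The vertices covered by a matching with index type `ι` number `2 |ι|`. -/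
theorem IsEdgeMatching.ncard_covered {V ι : Type*} [Finite V] [Fintype ι] {G : SimpleGraph V}
    {e : ι → Sym2 V} (he : IsEdgeMatching G e) :
    {x | ∃ i, x ∈ e i}.ncard = 2 * Fintype.card ι := by
  classical
  have := Fintype.ofFinite V
  have h : {x | ∃ i, x ∈ e i} =
      ((Finset.univ.biUnion fun i => (e i).toFinset : Finset V) : Set V) := by
    ext x; simp
  rw [h, Set.ncard_coe_finset, Finset.card_biUnion]
  · rw [Finset.sum_congr rfl (fun i _ => Sym2.card_toFinset_of_not_isDiag _
      (G.not_isDiag_of_mem_edgeSet (he.1 i)))]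
    simp [mul_comm]
  · intro i _ j _ hij
    rw [Function.onFun, Finset.disjoint_left]
    intro x hx hy
    exact hij (he.2 (by simpa using hx) (by simpa using hy))

/-- A matching induces a fixed-point-free permutation of its vertices. -/
theorem IsEdgeMatching.exists_perm {V ι : Type*} {G : SimpleGraph V} {e : ι → Sym2 V}
    (he : IsEdgeMatching G e) {T : Finset V} (hT : ∀ x, x ∈ T ↔ ∃ i, x ∈ e i) :
    ∃ τ : Equiv.Perm {x // x ∈ T}, ∀ i : {x // x ∈ T}, G.Adj i (τ i) := by
  have h : ∀ x : {x // x ∈ T}, ∃ y : {x // x ∈ T}, ∃ i, e i = s((x : V), (y : V)) := by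
    rintro ⟨x, hx⟩
    obtain ⟨i, hi⟩ := (hT x).1 hx
    obtain ⟨y, hy⟩ := Sym2.mem_iff_exists.1 hi
    exact ⟨⟨y, (hT y).2 ⟨i, by simp [hy]⟩⟩, i, hy⟩
  choose f g hfg using h
  have hinv : Function.Involutive f := by
    intro x
    have h1 := hfg x
    have h2 := hfg (f x)
    have h3 : g x = g (f x) := he.2 (x := (f x : V)) (by simp [h1]) (by simp [h2])
    rw [← h3, h1, Sym2.eq_swap] at h2
    exact (Subtype.ext (Sym2.congr_right.1 h2)).symm
  refine ⟨hinv.toPerm, fun i => ?_⟩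
  have := he.1 (g i)
  rwa [hfg i] at this

/-- König's theorem for forests. -/
theorem exists_cover_of_isAcyclic {V : Type*} [Finite V] (G : SimpleGraph V) (hG : G.IsAcyclic) :
    ∃ K : Set V, K.ncard ≤ matchingNumber G ∧ ∀ x y, G.Adj x y → x ∈ K ∨ y ∈ K := by
  induction hn : G.edgeSet.ncard using Nat.strong_induction_on generalizing G with
  | _ n ih =>
    by_cases hb : G = ⊥
    · exact ⟨∅, by simp, by simp [hb]⟩
    obtain ⟨a, b, hab⟩ : ∃ a b, G.Adj a b := by
      by_contra! h
      exact hb (by ext a b; simpa using h a b)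
    have : Nonempty V := ⟨a⟩
    -- An end u of a longest path is a leaf. Its neighbour y joins the cover, and after removing the
    -- edges at y the edge uy can be added to any matching of the rest.
    obtain ⟨u, v, p, hp, hmax⟩ := SimpleGraph.Walk.exists_isPath_forall_isPath_length_le_length G
    have hnil : ¬ p.Nil := by
      intro h
      have h1 := hmax a b hab.toWalk (by simp [hab.ne])
      have h2 := SimpleGraph.Walk.length_eq_zero_iff.2 h
      simp at h1
      omega
    have huniq : ∀ w, G.Adj u w → w = p.snd := by
      intro w hadj
      apply hG.eq_snd_of_adj_start hp hadj
      have : ¬(p.cons hadj.symm).IsPath := by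
        intro h
        have := hmax _ _ _ h
        simp at this
      by_contra hw
      exact this (hp.cons hw)
    set y := p.snd
    have huy : G.Adj u y := p.adj_snd hnil
    let H := G.deleteEdges {e | y ∈ e}
    have hHadj : ∀ x z, H.Adj x z ↔ G.Adj x z ∧ y ≠ x ∧ y ≠ z := by
      intro x z; simp [H, SimpleGraph.deleteEdges_adj]
    have hHG : H ≤ G := SimpleGraph.deleteEdges_le _
    have hlt : H.edgeSet.ncard < n := by
      rw [← hn]
      refine Set.ncard_lt_ncard ⟨SimpleGraph.edgeSet_mono hHG, fun h => ?_⟩ (Set.toFinite _)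
      have h3 := h (show s(u, y) ∈ G.edgeSet from huy)
      rw [SimpleGraph.mem_edgeSet, hHadj] at h3
      exact h3.2.2 rfl
    obtain ⟨K, hK, hcov⟩ := ih _ hlt H (hG.anti hHG) rfl
    obtain ⟨e, he⟩ := exists_isEdgeMatching H
    have hnot : ∀ i, u ∉ e i ∧ y ∉ e i := by
      intro i
      have h1 := he.1 i
      refine ⟨fun h => ?_, fun h => ?_⟩
      · obtain ⟨z, hz⟩ := Sym2.mem_iff_exists.1 h
        rw [hz, SimpleGraph.mem_edgeSet, hHadj] at h1
        exact h1.2.2 (huniq z h1.1).symm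
      · obtain ⟨z, hz⟩ := Sym2.mem_iff_exists.1 h
        rw [hz, SimpleGraph.mem_edgeSet, hHadj] at h1
        exact h1.2.1 rfl
    have hM : IsEdgeMatching G (fun o : Option (Fin (matchingNumber H)) => o.elim s(u, y) e) := by
      refine ⟨?_, ?_⟩
      · rintro (_ | i)
        · exact huy
        · exact SimpleGraph.edgeSet_mono hHG (he.1 i)
      · rintro (_ | i) (_ | j) x hx hy
        · rfl
        · simp only [Option.elim_none, Sym2.mem_iff, Option.elim_some] at hx hy
          rcases hx with rfl | rfl
          exacts [absurd hy (hnot j).1, absurd hy (hnot j).2]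
        · simp only [Option.elim_none, Sym2.mem_iff, Option.elim_some] at hx hy
          rcases hy with rfl | rfl
          exacts [absurd hx (hnot i).1, absurd hx (hnot i).2]
        · exact congrArg some (he.2 hx hy)
    have hcard := hM.card_le
    rw [Fintype.card_option, Fintype.card_fin] at hcard
    refine ⟨insert y K, (Set.ncard_insert_le _ _).trans (by omega), fun x z hxz => ?_⟩
    by_cases h1 : y = x
    · exact Or.inl (Or.inl h1.symm)
    by_cases h2 : y = z
    · exact Or.inr (Or.inl h2.symm)
    · rcases hcov x z ((hHadj x z).2 ⟨hxz, h1, h2⟩) with h | h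
      · exact Or.inl (Or.inr h)
      · exact Or.inr (Or.inr h)

end GainGraph

/-! ### Cycles of the graph as orbits of permutations -/

namespace GainGraph

/-- `s` is an orbit of `σ` with at least three points along which `σ` moves through edges
of `G`. -/
structure IsCyclicOrbit {V : Type*} (G : SimpleGraph V) (σ : Equiv.Perm V) (s : Finset V) :
    Prop where
  isCycleOn : σ.IsCycleOn (s : Set V)
  three_le : 3 ≤ s.card
  adj : ∀ x ∈ s, G.Adj x (σ x)

/-- The subgraph `C` is the closed trajectory of `σ` on `s`. -/
structure IsTrajectory {V : Type*} {G : SimpleGraph V} (C : G.Subgraph) (σ : Equiv.Perm V)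
    (s : Finset V) : Prop extends IsCyclicOrbit G σ s where
  verts : C.verts = s
  adj_iff : ∀ x y, C.Adj x y ↔ (x ∈ s ∧ y = σ x) ∨ (y ∈ s ∧ x = σ y)

variable {V : Type*} {G : SimpleGraph V} {σ : Equiv.Perm V} {s : Finset V}

theorem IsCyclicOrbit.apply_mem (h : IsCyclicOrbit G σ s) {x : V} (hx : x ∈ s) : σ x ∈ s := by
  have := (h.isCycleOn.apply_mem_iff (x := x)).2 hx
  exact_mod_cast this

theorem IsCyclicOrbit.pow_apply_mem (h : IsCyclicOrbit G σ s) {x : V} (hx : x ∈ s) (n : ℕ) :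
    (σ ^ n) x ∈ s := by
  induction n with
  | zero => simpa
  | succ n ih => rw [pow_succ', Equiv.Perm.mul_apply]; exact h.apply_mem ih

theorem isTrajectory_of_walk {v : V} {w : G.Walk v v} (hw : w.IsCycle)
    (hs : IsCyclicOrbit G σ s) (hsw : ∀ x, x ∈ s ↔ ∃ i < w.length, w.getVert i = x)
    (hσ : ∀ i < w.length, σ (w.getVert i) = w.getVert (i + 1)) :
    IsTrajectory w.toSubgraph σ s := by
  refine ⟨hs, ?_, ?_⟩
  · ext x
    rw [SimpleGraph.Walk.mem_verts_toSubgraph, SimpleGraph.Walk.mem_support_iff_exists_getVert,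
      Finset.mem_coe, hsw]
    constructor
    · rintro ⟨i, hi, hle⟩
      rcases hle.lt_or_eq with h | h
      · exact ⟨i, h, hi⟩
      -- The closed walk ends where it starts, so its last index is replaced by 0.
      · refine ⟨0, by have := hw.three_le_length; omega, ?_⟩
        rw [← hi, h]
        simp
    · rintro ⟨i, hi, hle⟩
      exact ⟨i, hle, hi.le⟩
  · intro x y
    rw [SimpleGraph.Walk.toSubgraph_adj_iff]
    constructor
    · rintro ⟨i, hi, hlt⟩
      rw [Sym2.eq_iff] at hi
      rcases hi with ⟨h1, h2⟩ | ⟨h1, h2⟩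
      · exact Or.inl ⟨(hsw x).2 ⟨i, hlt, h1⟩, by rw [← h1, ← h2, hσ i hlt]⟩
      · exact Or.inr ⟨(hsw y).2 ⟨i, hlt, h1⟩, by rw [← h1, ← h2, hσ i hlt]⟩
    · rintro (⟨hx, rfl⟩ | ⟨hx, rfl⟩)
      · obtain ⟨i, hi, rfl⟩ := (hsw x).1 hx
        exact ⟨i, by rw [hσ i hi], hi⟩
      · obtain ⟨i, hi, rfl⟩ := (hsw y).1 hx
        exact ⟨i, by rw [hσ i hi, Sym2.eq_swap], hi⟩

theorem exists_walk_getVert_eq_pow (hs : IsCyclicOrbit G σ s) {v : V} (hv : v ∈ s) (n : ℕ) :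
    ∃ w : G.Walk v ((σ ^ n) v), w.length = n ∧ ∀ i ≤ n, w.getVert i = (σ ^ i) v := by
  induction n with
  | zero =>
    refine ⟨SimpleGraph.Walk.nil' v, rfl, fun i hi => ?_⟩
    obtain rfl : i = 0 := by omega
    rfl
  | succ n ih =>
    obtain ⟨w, hl, hw⟩ := ih
    have hadj : G.Adj ((σ ^ n) v) ((σ ^ (n + 1)) v) := by
      rw [pow_succ', Equiv.Perm.mul_apply]
      exact hs.adj _ (hs.pow_apply_mem hv n)
    refine ⟨w.concat hadj, by simp [hl], fun i hi => ?_⟩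
    rcases hi.lt_or_eq with h | h
    · rw [SimpleGraph.Walk.concat_eq_append, SimpleGraph.Walk.getVert_append, hl]
      split_ifs with hin
      · exact hw i (by omega)
      · obtain rfl : i = n := by omega
        simp
    · subst h
      exact SimpleGraph.Walk.getVert_of_length_le _ (by simp [hl])

theorem IsCyclicOrbit.pow_injOn (hs : IsCyclicOrbit G σ s) {v : V} (hv : v ∈ s) {i j : ℕ}
    (hi : i < s.card) (hj : j < s.card) (h : (σ ^ i) v = (σ ^ j) v) : i = j := by
  have := (hs.isCycleOn.pow_apply_eq_pow_apply hv).1 h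
  rwa [Nat.ModEq, Nat.mod_eq_of_lt hi, Nat.mod_eq_of_lt hj] at this

/-- A cyclic orbit is traversed by a cycle. -/
theorem IsCyclicOrbit.exists_isTrajectory (hs : IsCyclicOrbit G σ s) :
    ∃ C ∈ cycleSubgraphs G, IsTrajectory C σ s := by
  have h3 := hs.three_le
  obtain ⟨v, hv⟩ : s.Nonempty := Finset.card_pos.1 (by omega)
  obtain ⟨n, hn⟩ : ∃ n, s.card = n + 1 := ⟨s.card - 1, by omega⟩
  obtain ⟨p, hl, hp⟩ := exists_walk_getVert_eq_pow hs hv n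
  have hlast : σ ((σ ^ n) v) = v := by
    rw [← Equiv.Perm.mul_apply, ← pow_succ', ← hn]
    exact hs.isCycleOn.pow_card_apply hv
  have hadj : G.Adj ((σ ^ n) v) v := by
    have := hs.adj _ (hs.pow_apply_mem hv n)
    rwa [hlast] at this
  have hpath : p.IsPath := by
    rw [← SimpleGraph.Walk.IsPath.getVert_injOn_iff]
    intro i hi j hj hij
    simp only [Set.mem_ofPred_eq, hl] at hi hj
    rw [hp i hi, hp j hj] at hij
    exact hs.pow_injOn hv (by omega) (by omega) hij
  have hcyc : (SimpleGraph.Walk.cons hadj p).IsCycle := by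
    rw [SimpleGraph.Walk.cons_isCycle_iff]
    -- If the closing edge were an edge of the path, then either i = n, although i < n, or i = 0 and
    -- n = 1, against an orbit of at least three points.
    refine ⟨hpath, fun hmem => ?_⟩
    rw [← SimpleGraph.Walk.mem_edges_toSubgraph, SimpleGraph.Subgraph.mem_edgeSet,
      SimpleGraph.Walk.toSubgraph_adj_iff] at hmem
    obtain ⟨i, hi, hlt⟩ := hmem
    rw [hl] at hlt
    rw [hp i hlt.le, hp (i + 1) hlt, Sym2.eq_iff] at hi
    rcases hi with ⟨h1, h2⟩ | ⟨h1, h2⟩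
    · have := hs.pow_injOn hv (by omega) (by omega) h1
      omega
    · have h4 : (σ ^ i) v = (σ ^ 0) v := by simpa using h1
      have h5 := hs.pow_injOn hv (by omega) (by omega) h4
      have h6 := hs.pow_injOn hv (by omega) (by omega) h2
      omega
  refine ⟨_, ⟨_, _, hcyc, rfl⟩, isTrajectory_of_walk hcyc hs ?_ ?_⟩
  · intro x
    constructor
    · intro hx
      obtain ⟨i, hi, rfl⟩ := hs.isCycleOn.exists_pow_eq hv hx
      by_cases hin : i = n
      · subst hin
        exact ⟨0, by simp, by simp⟩
      · exact ⟨i + 1, by simp; omega, by simp; exact hp i (by omega)⟩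
    · rintro ⟨i, hi, rfl⟩
      cases i with
      | zero => simpa using hs.pow_apply_mem hv n
      | succ i =>
        simp only [SimpleGraph.Walk.length_cons, hl] at hi
        rw [SimpleGraph.Walk.getVert_cons_succ, hp i (by omega)]
        exact hs.pow_apply_mem hv i
  · intro i hi
    simp only [SimpleGraph.Walk.length_cons, hl] at hi
    cases i with
    | zero => simp [hlast]
    | succ i =>
      rw [SimpleGraph.Walk.getVert_cons_succ, SimpleGraph.Walk.getVert_cons_succ, hp i (by omega),
        hp (i + 1) (by omega), pow_succ', Equiv.Perm.mul_apply]

/-- A cycle is the trajectory of a permutation. -/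
theorem exists_isTrajectory_of_isCycle {v : V} {w : G.Walk v v} (hw : w.IsCycle) :
    ∃ σ s, IsTrajectory w.toSubgraph σ s ∧ s.card = w.length ∧
      (∀ i < w.length, σ (w.getVert i) = w.getVert (i + 1)) ∧
      ∀ x, x ∈ s ↔ ∃ i < w.length, w.getVert i = x := by
  classical
  -- Dropping the repeated base vertex leaves a list without duplicates; `List.formPerm` rotates it.
  set l := w.support.dropLast with hl
  have hlen : l.length = w.length := by simp [hl]
  have hnd : l.Nodup := hw.nodup_dropLast_support
  have hget : ∀ i (hi : i < l.length), l[i] = w.getVert i := by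
    intro i hi
    simp [hl, SimpleGraph.Walk.support_getElem_eq_getVert]
  have h3 := hw.three_le_length
  have hσ : ∀ i < w.length, l.formPerm (w.getVert i) = w.getVert (i + 1) := by
    intro i hi
    rw [← hget i (by omega), List.formPerm_apply_getElem _ hnd, hget]
    rcases Nat.lt_or_ge (i + 1) l.length with h | h
    · rw [Nat.mod_eq_of_lt h]
    · have : i + 1 = l.length := by omega
      rw [this, Nat.mod_self, hlen]
      simp
  have hmem : ∀ x, x ∈ l.toFinset ↔ ∃ i < w.length, w.getVert i = x := by
    intro x
    rw [List.mem_toFinset, List.mem_iff_getElem]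
    constructor
    · rintro ⟨i, hi, rfl⟩
      exact ⟨i, by omega, (hget i hi).symm⟩
    · rintro ⟨i, hi, rfl⟩
      exact ⟨i, by omega, hget i (by omega)⟩
  have hcard : l.toFinset.card = w.length := by rw [List.toFinset_card_of_nodup hnd, hlen]
  refine ⟨l.formPerm, l.toFinset, isTrajectory_of_walk hw ⟨?_, ?_, ?_⟩ hmem hσ, hcard, hσ, hmem⟩
  · have := hnd.isCycleOn_formPerm
    rwa [← List.coe_toFinset] at this
  · omega
  · intro x hx
    obtain ⟨i, hi, rfl⟩ := (hmem x).1 hx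
    rw [hσ i hi]
    exact w.adj_getVert_succ hi

theorem exists_isTrajectory {C : G.Subgraph} (hC : C ∈ cycleSubgraphs G) :
    ∃ σ s, IsTrajectory C σ s := by
  obtain ⟨v, w, hw, rfl⟩ := hC
  obtain ⟨σ, s, h, -⟩ := exists_isTrajectory_of_isCycle hw
  exact ⟨σ, s, h⟩

/-- The gain of a cycle as a product over its vertices. -/
theorem walkGain_eq_prod (φ : UnitGain G) {v : V} {w : G.Walk v v} (hw : w.IsCycle)
    (hsw : ∀ x, x ∈ s ↔ ∃ i < w.length, w.getVert i = x)
    (hσ : ∀ i < w.length, σ (w.getVert i) = w.getVert (i + 1)) :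
    (φ.walkGain w : ℂ) = ∏ x ∈ s, φ.adjMatrix x (σ x) := by
  classical
  have h1 : s = (Finset.range w.length).image w.getVert := by
    ext x; rw [hsw]; simp
  have h3 := hw.three_le_length
  rw [h1, Finset.prod_image, Finset.prod_range]
  · have hcoe : ∀ (n : ℕ) (f : Fin n → Circle), ((∏ i, f i : Circle) : ℂ) = ∏ i, (f i : ℂ) :=
      fun n f => map_prod Circle.coeHom f Finset.univ
    rw [UnitGain.walkGain, ← Fin.prod_univ_getElem, hcoe]
    refine Fintype.prod_equiv (finCongr (by simp)) _ _ (fun i => ?_)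
    have hi : (i : ℕ) < w.length := by
      have := i.2
      simpa using this
    have hadj := w.adj_getVert_succ hi
    simp only [List.getElem_map, finCongr_apply, Fin.val_cast, hσ i hi,
      SimpleGraph.Walk.darts_getElem_eq_getVert, UnitGain.adjMatrix, Matrix.of_apply, dif_pos hadj]
  · intro i hi j hj hij
    simp only [Finset.coe_range, Set.mem_Iio] at hi hj
    exact hw.getVert_injOn' (by simp; omega) (by simp; omega) hij

/-- Edges paired up along an orbit, starting from a given vertex; an odd orbit misses only its
starting vertex. -/
def orbitEdge {V : Type*} (σ : Equiv.Perm V) (z : V) (i : ℕ) : Sym2 V :=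
  s((σ ^ (2 * i + 1)) z, (σ ^ (2 * i + 2)) z)

theorem mem_orbitEdge {z x : V} {i : ℕ} :
    x ∈ orbitEdge σ z i ↔ ∃ k, (k = 2 * i + 1 ∨ k = 2 * i + 2) ∧ x = (σ ^ k) z := by
  simp [orbitEdge]

theorem IsCycleOn.pow_mem (hs : σ.IsCycleOn (s : Set V)) {z : V} (hz : z ∈ s) (n : ℕ) :
    (σ ^ n) z ∈ s := by
  induction n with
  | zero => simpa
  | succ n ih =>
    rw [pow_succ', Equiv.Perm.mul_apply]
    exact_mod_cast (hs.apply_mem_iff (x := (σ ^ n) z)).2 ih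

theorem mem_of_mem_orbitEdge (hs : σ.IsCycleOn (s : Set V)) {z x : V} (hz : z ∈ s) {i : ℕ}
    (hx : x ∈ orbitEdge σ z i) : x ∈ s := by
  obtain ⟨k, -, rfl⟩ := mem_orbitEdge.1 hx
  exact IsCycleOn.pow_mem hs hz k

theorem orbitEdge_mem_edgeSet (hs : σ.IsCycleOn (s : Set V)) (hadj : ∀ x ∈ s, G.Adj x (σ x))
    {z : V} (hz : z ∈ s) (i : ℕ) : orbitEdge σ z i ∈ G.edgeSet := by
  have := hadj _ (IsCycleOn.pow_mem hs hz (2 * i + 1))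
  rwa [← Equiv.Perm.mul_apply, ← pow_succ'] at this

theorem orbitEdge_disjoint (hs : σ.IsCycleOn (s : Set V)) {z x : V} (hz : z ∈ s) {i j : ℕ}
    (hi : i < s.card / 2) (hj : j < s.card / 2) (hxi : x ∈ orbitEdge σ z i)
    (hxj : x ∈ orbitEdge σ z j) : i = j := by
  obtain ⟨a, ha, rfl⟩ := mem_orbitEdge.1 hxi
  obtain ⟨b, hb, hab⟩ := mem_orbitEdge.1 hxj
  have h1 := (hs.pow_apply_eq_pow_apply hz).1 hab
  -- The exponents range over 1, …, |s|; lowering them by one makes them reduced residues modulo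
  -- |s|.
  obtain ⟨a, rfl⟩ : ∃ a', a = a' + 1 := ⟨a - 1, by omega⟩
  obtain ⟨b, rfl⟩ : ∃ b', b = b' + 1 := ⟨b - 1, by omega⟩
  have h2 := Nat.ModEq.add_right_cancel' 1 h1
  rw [Nat.ModEq, Nat.mod_eq_of_lt (by omega), Nat.mod_eq_of_lt (by omega)] at h2
  omega

/-- For odd |s| the exponents stay between 1 and |s| - 1. The vertex z remains free for an edge
leaving the cycle. -/
theorem notMem_orbitEdge_of_odd (hs : σ.IsCycleOn (s : Set V)) {z : V} (hz : z ∈ s) {i : ℕ}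
    (hi : i < s.card / 2) (hodd : Odd s.card) : z ∉ orbitEdge σ z i := by
  intro h
  obtain ⟨k, hk, hzk⟩ := mem_orbitEdge.1 h
  have h1 := (hs.pow_apply_eq hz).1 hzk.symm
  obtain ⟨m, hm⟩ := hodd
  have := Nat.le_of_dvd (by omega) h1
  omega

end GainGraph

/-! ### Disjoint cycles and the cyclomatic number; the contraction is a forest -/

namespace GainGraph

variable {V : Type*} {G : SimpleGraph V} {σ : Equiv.Perm V} {s : Finset V}

theorem IsCyclicOrbit.apply_apply_ne (hs : IsCyclicOrbit G σ s) {x : V} (hx : x ∈ s) :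
    σ (σ x) ≠ x := by
  intro h
  have h2 : (σ ^ 2) x = x := by rwa [pow_two, Equiv.Perm.mul_apply]
  have := Nat.le_of_dvd (by omega) ((hs.isCycleOn.pow_apply_eq hx).1 h2)
  have := hs.three_le
  omega

theorem IsCyclicOrbit.exists_apply_eq (hs : IsCyclicOrbit G σ s) {x : V} (hx : x ∈ s) :
    ∃ y ∈ s, σ y = x := by
  refine ⟨σ⁻¹ x, ?_, by simp⟩
  have := (hs.isCycleOn.apply_mem_iff (x := σ⁻¹ x)).1 (by simpa using hx)
  exact_mod_cast this

/-- A set invariant under `σ` and meeting the orbit `s` contains it. -/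
theorem subset_of_forall_apply_mem (hs : σ.IsCycleOn (s : Set V)) {t : Set V} {z : V} (hz : z ∈ s)
    (hzt : z ∈ t) (ht : ∀ x ∈ s, x ∈ t → σ x ∈ t) : ∀ x ∈ s, x ∈ t := by
  intro x hx
  obtain ⟨n, -, rfl⟩ := hs.exists_pow_eq hz hx
  clear hx
  induction n with
  | zero => simpa
  | succ n ih =>
    rw [pow_succ', Equiv.Perm.mul_apply]
    exact ht _ (IsCycleOn.pow_mem hs hz n) ih

/-- A cycle contained in another cycle is equal to it. -/
theorem cycle_eq_of_le {C D : G.Subgraph} (hC : C ∈ cycleSubgraphs G) (hD : D ∈ cycleSubgraphs G)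
    (h : ∀ x y, D.Adj x y → C.Adj x y) : D = C := by
  obtain ⟨σ, s, hσ⟩ := exists_isTrajectory hC
  obtain ⟨τ, t, hτ⟩ := exists_isTrajectory hD
  have hts : ∀ x ∈ t, x ∈ s := by
    intro x hx
    have h1 : C.Adj x (τ x) := h _ _ ((hτ.adj_iff _ _).2 (Or.inl ⟨hx, rfl⟩))
    have := C.edge_vert h1
    rwa [hσ.verts] at this
  -- The two D-neighbours of x are distinct and lie among its C-neighbours σ x and σ⁻¹ x, so one of
  -- them is σ x.
  have key : ∀ x ∈ t, D.Adj x (σ x) := by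
    intro x hx
    have h1 : D.Adj x (τ x) := (hτ.adj_iff _ _).2 (Or.inl ⟨hx, rfl⟩)
    obtain ⟨y, hy, rfl⟩ := hτ.exists_apply_eq hx
    have h2 : D.Adj (τ y) y := (hτ.adj_iff _ _).2 (Or.inr ⟨hy, rfl⟩)
    rcases (hσ.adj_iff _ _).1 (h _ _ h1) with ⟨-, h3⟩ | ⟨-, h3⟩
    · rwa [← h3]
    · rcases (hσ.adj_iff _ _).1 (h _ _ h2) with ⟨-, h4⟩ | ⟨-, h4⟩
      · rwa [← h4]
      · rw [h4] at h3
        have := σ.injective h3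
        exact absurd (by rw [← h4] at this; exact this.symm) (hτ.apply_apply_ne hy)
  obtain ⟨z, hz⟩ : t.Nonempty := Finset.card_pos.1 (by have := hτ.three_le; omega)
  have hst : ∀ x ∈ s, x ∈ t := by
    refine subset_of_forall_apply_mem hσ.isCycleOn (hts z hz) (t := (t : Set V)) hz ?_
    intro x _ hx
    have := D.edge_vert (key x hx).symm
    rwa [hτ.verts] at this
  refine SimpleGraph.Subgraph.ext ?_ ?_
  · rw [hσ.verts, hτ.verts]
    exact Set.Subset.antisymm hts hst
  · funext x y
    refine propext ⟨h x y, fun hxy => ?_⟩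
    rcases (hσ.adj_iff _ _).1 hxy with ⟨hx, rfl⟩ | ⟨hx, rfl⟩
    · exact key x (hst x hx)
    · exact (key y (hst y hx)).symm

theorem reachable_of_forall_adj {G H : SimpleGraph V} (h : ∀ x y, G.Adj x y → H.Reachable x y)
    {a b : V} (hab : G.Reachable a b) : H.Reachable a b := by
  obtain ⟨p⟩ := hab
  induction p with
  | nil => exact SimpleGraph.Reachable.refl _
  | cons hadj _ ih => exact (h _ _ hadj).trans ih

/-- Deleting one edge of a cycle keeps its endpoints connected within the cycle. -/
theorem reachable_deleteEdges_cycle {C : G.Subgraph} (hC : C ∈ cycleSubgraphs G) {x y : V}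
    (hxy : C.Adj x y) : (C.spanningCoe.deleteEdges {s(x, y)}).Reachable x y := by
  obtain ⟨v, w, hw, rfl⟩ := hC
  have hE : ∀ e ∈ w.edges, e ∈ w.toSubgraph.spanningCoe.edgeSet := by
    intro e he
    rw [SimpleGraph.Subgraph.edgeSet_spanningCoe]
    exact w.mem_edges_toSubgraph.2 he
  refine (SimpleGraph.adj_and_reachable_delete_edges_iff_exists_cycle.2
    ⟨v, w.transfer _ hE, hw.transfer hE, ?_⟩).2
  rw [SimpleGraph.Walk.edges_transfer]
  exact w.mem_edges_toSubgraph.1 hxy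

section Deletion

variable {ι : Type*} {C : ι → G.Subgraph} {e : ι → Sym2 V}

/-- The rest of its cycle bypasses a deleted edge, and by disjointness it contains no other deleted
edge. -/
theorem connected_deleteEdges (hG : G.Connected) (hC : ∀ i, C i ∈ cycleSubgraphs G)
    (hd : ∀ i j, i ≠ j → Disjoint (C i).verts (C j).verts) (he : ∀ i, e i ∈ (C i).edgeSet) :
    (G.deleteEdges (Set.range e)).Connected := by
  have hreach : ∀ x y, G.Adj x y → (G.deleteEdges (Set.range e)).Reachable x y := by
    intro x y hxy
    by_cases hmem : s(x, y) ∈ Set.range e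
    · obtain ⟨i, hi⟩ := hmem
      have hCi : (C i).Adj x y := by
        have := he i
        rwa [hi] at this
      refine (reachable_deleteEdges_cycle (hC i) hCi).mono ?_
      intro a b hab
      rw [SimpleGraph.deleteEdges_adj] at hab ⊢
      refine ⟨(C i).adj_sub hab.1, ?_⟩
      rintro ⟨j, hj⟩
      by_cases hij : i = j
      · subst hij
        exact hab.2 (by rw [← hj, hi]; rfl)
      · have h1 : (C j).Adj a b := by
          have := he j
          rwa [hj] at this
        exact Set.disjoint_left.1 (hd i j hij) ((C i).edge_vert hab.1) ((C j).edge_vert h1)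
    · exact SimpleGraph.Adj.reachable (SimpleGraph.deleteEdges_adj.2 ⟨hxy, hmem⟩)
  have := hG.nonempty
  exact ⟨fun a b => reachable_of_forall_adj hreach (hG.preconnected a b)⟩

theorem card_deleteEdges [Finite V] [Fintype ι]
    (hd : ∀ i j, i ≠ j → Disjoint (C i).verts (C j).verts) (he : ∀ i, e i ∈ (C i).edgeSet) :
    Nat.card (G.deleteEdges (Set.range e)).edgeSet + Fintype.card ι = Nat.card G.edgeSet := by
  have hinj : Function.Injective e := by
    intro i j hij
    by_contra hne
    have h1 : (e i).out.1 ∈ (C i).verts :=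
      (C i).mem_verts_of_mem_edge (he i) (Sym2.out_fst_mem _)
    have h2 : (e i).out.1 ∈ (C j).verts :=
      (C j).mem_verts_of_mem_edge (he j) (hij ▸ Sym2.out_fst_mem _)
    exact Set.disjoint_left.1 (hd i j hne) h1 h2
  have hsub : Set.range e ⊆ G.edgeSet := by
    rintro _ ⟨i, rfl⟩
    exact (C i).edgeSet_subset (he i)
  have hcard : (Set.range e).ncard = Fintype.card ι := by
    rw [← Set.image_univ, Set.ncard_image_of_injective _ hinj, Set.ncard_univ,
      Nat.card_eq_fintype_card]
  rw [SimpleGraph.edgeSet_deleteEdges, ← hcard]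
  exact Set.ncard_sdiff_add_ncard_of_subset hsub (Set.toFinite _)

theorem cyclomaticNumber_eq (hG : G.Connected) :
    cyclomaticNumber G = Nat.card G.edgeSet - Nat.card V + 1 := by
  have : Nat.card G.ConnectedComponent = 1 := by
    rw [Nat.card_eq_one_iff_unique]
    have := hG.nonempty
    exact ⟨hG.preconnected.subsingleton_connectedComponent, inferInstance⟩
  rw [cyclomaticNumber, this]
  simp

theorem exists_mem_edgeSet {D : G.Subgraph} (hD : D ∈ cycleSubgraphs G) : ∃ e, e ∈ D.edgeSet := by
  obtain ⟨σ, s, h⟩ := exists_isTrajectory hD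
  obtain ⟨z, hz⟩ : s.Nonempty := Finset.card_pos.1 (by have := h.three_le; omega)
  exact ⟨s(z, σ z), (h.adj_iff _ _).2 (Or.inl ⟨hz, rfl⟩)⟩

/-- After one edge per cycle is deleted the graph is still connected, so at least |V| - 1 edges
remain. -/
theorem card_le_cyclomaticNumber [Finite V] [Fintype ι] (hG : G.Connected)
    (hC : ∀ i, C i ∈ cycleSubgraphs G)
    (hd : ∀ i j, i ≠ j → Disjoint (C i).verts (C j).verts) :
    (Fintype.card ι : ℤ) ≤ cyclomaticNumber G := by
  choose e he using fun i => exists_mem_edgeSet (hC i)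
  have h1 := (connected_deleteEdges hG hC hd he).card_vert_le_card_edgeSet_add_one
  have h2 := card_deleteEdges hd he
  rw [cyclomaticNumber_eq hG]
  omega

/-- Equality in the edge count of `card_le_cyclomaticNumber` leaves a tree. -/
theorem isAcyclic_deleteEdges [Finite V] [Fintype ι] (hG : G.Connected)
    (hC : ∀ i, C i ∈ cycleSubgraphs G)
    (hd : ∀ i j, i ≠ j → Disjoint (C i).verts (C j).verts) (he : ∀ i, e i ∈ (C i).edgeSet)
    (hcard : (Fintype.card ι : ℤ) = cyclomaticNumber G) :
    (G.deleteEdges (Set.range e)).IsAcyclic := by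
  refine (SimpleGraph.isTree_iff_connected_and_card.2
    ⟨connected_deleteEdges hG hC hd he, ?_⟩).isAcyclic
  have h2 := card_deleteEdges hd he
  rw [cyclomaticNumber_eq hG] at hcard
  omega

theorem not_isAcyclic_of_forall_mem {H : SimpleGraph V} {D : G.Subgraph}
    (hD : D ∈ cycleSubgraphs G) (h : ∀ e ∈ D.edgeSet, e ∈ H.edgeSet) : ¬ H.IsAcyclic := by
  obtain ⟨v, w, hw, rfl⟩ := hD
  have h' : ∀ e ∈ w.edges, e ∈ H.edgeSet := fun e he => h e (w.mem_edges_toSubgraph.2 he)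
  exact fun hH => hH _ (hw.transfer h')

/-- If a family of disjoint cycles has as many members as the cyclomatic number, it consists of
all cycles. -/
theorem exists_eq_of_card_eq [Finite V] [Fintype ι] (hG : G.Connected)
    (hC : ∀ i, C i ∈ cycleSubgraphs G)
    (hd : ∀ i j, i ≠ j → Disjoint (C i).verts (C j).verts)
    (hcard : (Fintype.card ι : ℤ) = cyclomaticNumber G) {D : G.Subgraph}
    (hD : D ∈ cycleSubgraphs G) : ∃ i, C i = D := by
  by_contra! hne
  -- Deleting from each `C i` an edge outside D leaves a forest that still contains D.
  have : ∀ i, ∃ e, e ∈ (C i).edgeSet ∧ e ∉ D.edgeSet := by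
    intro i
    by_contra! hcon
    exact hne i (cycle_eq_of_le hD (hC i) fun x y hxy => hcon s(x, y) hxy)
  choose e he heD using this
  refine not_isAcyclic_of_forall_mem hD ?_ (isAcyclic_deleteEdges hG hC hd he hcard)
  intro f hf
  rw [SimpleGraph.edgeSet_deleteEdges]
  refine ⟨D.edgeSet_subset hf, ?_⟩
  rintro ⟨i, rfl⟩
  exact heD i hf

/-- If the cycles are pairwise disjoint, then their number is the cyclomatic number. -/
theorem card_cycleSubgraphs [Finite V] (hG : G.Connected)
    (hd : (cycleSubgraphs G).PairwiseDisjoint SimpleGraph.Subgraph.verts) :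
    (Nat.card (cycleSubgraphs G) : ℤ) = cyclomaticNumber G := by
  have : Fintype (cycleSubgraphs G) := Fintype.ofFinite _
  have hC : ∀ i : cycleSubgraphs G, (i : G.Subgraph) ∈ cycleSubgraphs G := fun i => i.2
  have hd' : ∀ i j : cycleSubgraphs G, i ≠ j →
      Disjoint (i : G.Subgraph).verts (j : G.Subgraph).verts :=
    fun i j hij => hd i.2 j.2 (fun h => hij (Subtype.ext h))
  choose e he using fun i => exists_mem_edgeSet (hC i)
  have h1 := connected_deleteEdges hG hC hd' he
  have h2 := card_deleteEdges hd' he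
  -- A surviving cycle would be a cycle of G, and its own chosen edge has been deleted.
  have h3 : (G.deleteEdges (Set.range e)).IsAcyclic := by
    intro v w hw
    have hle := SimpleGraph.deleteEdges_le (G := G) (Set.range e)
    have hc : (w.mapLe hle).IsCycle := (SimpleGraph.Walk.isCycle_mapLe hle).2 hw
    have h4 := he ⟨(w.mapLe hle).toSubgraph, v, w.mapLe hle, hc, rfl⟩
    rw [SimpleGraph.Walk.mem_edges_toSubgraph, SimpleGraph.Walk.edges_mapLe_eq_edges] at h4
    have h5 := w.edges_subset_edgeSet h4
    rw [SimpleGraph.edgeSet_deleteEdges] at h5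
    exact h5.2 ⟨_, rfl⟩
  have h4 := (SimpleGraph.isTree_iff_connected_and_card.1 ⟨h1, h3⟩).2
  rw [cyclomaticNumber_eq hG, Nat.card_eq_fintype_card]
  omega

end Deletion

theorem reachable_of_mem_cycle {C : G.Subgraph} (hC : C ∈ cycleSubgraphs G) {x y : V}
    (hx : x ∈ C.verts) (hy : y ∈ C.verts) : C.spanningCoe.Reachable x y := by
  obtain ⟨v, w, hw, rfl⟩ := hC
  have hc := w.toSubgraph_connected
  have := hc.coe.preconnected ⟨x, hx⟩ ⟨y, hy⟩
  exact this.map (⟨Subtype.val, fun h => h⟩ : w.toSubgraph.coe →g w.toSubgraph.spanningCoe)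

/-- Vertices on a common cycle are identified in the contraction. -/
theorem mk_eq_of_mem_cycle {C : G.Subgraph} (hC : C ∈ cycleSubgraphs G) {x y : V}
    (hx : x ∈ C.verts) (hy : y ∈ C.verts) :
    Quotient.mk (cycleSetoid G) x = Quotient.mk (cycleSetoid G) y :=
  Quotient.sound (Relation.EqvGen.rel _ _ ⟨C, hC, hx, hy⟩)

/-- Contracting all cycles yields a forest. -/
theorem isAcyclic_contractCycles : (contractCycles G).IsAcyclic := by
  rw [SimpleGraph.isAcyclic_iff_forall_adj_isBridge]
  rintro a b ⟨hab, u, v, huv, rfl, rfl⟩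
  rw [SimpleGraph.isBridge_iff]
  -- If the contracted edge is not a bridge, a detour lifts to G minus uv: a cycle through uv would
  -- identify u and v, so each class stays connected without uv. Then uv closes a cycle with the
  -- lifted detour, and u and v are identified after all.
  intro hreach
  set H := G.deleteEdges {s(u, v)}
  have hcyc : ∀ x y, (cycleSetoid G) x y → H.Reachable x y := by
    intro x y hxy
    induction hxy with
    | rel x y h =>
      obtain ⟨C, hC, hx, hy⟩ := h
      refine (reachable_of_mem_cycle hC hx hy).mono ?_
      intro a b h1
      refine SimpleGraph.deleteEdges_adj.2 ⟨C.adj_sub h1, fun h2 => hab ?_⟩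
      have h3 : C.Adj u v := by
        rw [← SimpleGraph.Subgraph.mem_edgeSet, ← Set.mem_singleton_iff.1 h2]
        exact h1
      exact mk_eq_of_mem_cycle hC (C.edge_vert h3) (C.edge_vert h3.symm)
    | refl => exact SimpleGraph.Reachable.refl _
    | symm _ _ _ ih => exact ih.symm
    | trans _ _ _ _ _ ih1 ih2 => exact ih1.trans ih2
  have hlift : ∀ a b, ((contractCycles G).deleteEdges
      {s(Quotient.mk (cycleSetoid G) u, Quotient.mk (cycleSetoid G) v)}).Reachable a b →
      ∀ x y, Quotient.mk (cycleSetoid G) x = a → Quotient.mk (cycleSetoid G) y = b →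
        H.Reachable x y := by
    rintro a b ⟨p⟩
    induction p with
    | nil =>
      rintro x y rfl h
      exact hcyc x y (Quotient.exact h.symm)
    | cons hadj _ ih =>
      rintro x y rfl hy
      obtain ⟨⟨-, x', z, hxz, h1, rfl⟩, hne⟩ := SimpleGraph.deleteEdges_adj.1 hadj
      refine (hcyc x x' (Quotient.exact h1.symm)).trans
        ((SimpleGraph.Adj.reachable ?_).trans (ih z y rfl hy))
      refine SimpleGraph.deleteEdges_adj.2 ⟨hxz, fun h => hne ?_⟩
      rw [← h1]
      have := congrArg (Sym2.map (Quotient.mk (cycleSetoid G))) (Set.mem_singleton_iff.1 h)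
      simpa using this
  obtain ⟨w, p, hp, hmem⟩ := SimpleGraph.adj_and_reachable_delete_edges_iff_exists_cycle.1
    ⟨huv, hlift _ _ hreach u v rfl rfl⟩
  have hC : p.toSubgraph ∈ cycleSubgraphs G := ⟨w, p, hp, rfl⟩
  exact hab (mk_eq_of_mem_cycle hC
    (p.mem_verts_toSubgraph.2 (p.fst_mem_support_of_mem_edges hmem))
    (p.mem_verts_toSubgraph.2 (p.snd_mem_support_of_mem_edges hmem)))

end GainGraph

/-! ### Permutations moving along edges: the bound 2m + c and its equality case -/

namespace GainGraph

variable {V : Type*} {G : SimpleGraph V}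

theorem mem_cycleVertices {x : V} : x ∈ cycleVertices G ↔ ∃ C ∈ cycleSubgraphs G, x ∈ C.verts := by
  simp [cycleVertices]

section Perm

variable [Fintype V] [DecidableEq V] {σ : Equiv.Perm V}

/-- A point whose orbit has more than two elements lies on a cycle. -/
theorem mem_cycleVertices_of_apply_apply_ne (hσ : ∀ x ∈ σ.support, G.Adj x (σ x)) {x : V}
    (hx : σ (σ x) ≠ x) : x ∈ cycleVertices G := by
  have hx1 : σ x ≠ x := fun h => hx (by rw [h, h])
  set s := (σ.cycleOf x).support with hs
  have hon : σ.IsCycleOn (s : Set V) := Equiv.Perm.isCycleOn_support_cycleOf σ x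
  have hxs : x ∈ s := by
    rw [hs, Equiv.Perm.mem_support_cycleOf_iff' hx1]
  have hsub : ∀ y ∈ s, y ∈ σ.support := fun y hy => Equiv.Perm.support_cycleOf_le σ x hy
  have h3 : 3 ≤ s.card := by
    by_contra h
    have hpos : 0 < s.card := Finset.card_pos.2 ⟨x, hxs⟩
    have hdvd : s.card ∣ 2 := by
      have : s.card = 1 ∨ s.card = 2 := by omega
      rcases this with h | h <;> simp [h]
    have := (hon.pow_apply_eq hxs).2 hdvd
    exact hx (by rwa [pow_two, Equiv.Perm.mul_apply] at this)
  obtain ⟨C, hC, hT⟩ := IsCyclicOrbit.exists_isTrajectory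
    (G := G) ⟨hon, h3, fun y hy => hσ y (hsub y hy)⟩
  exact mem_cycleVertices.2 ⟨C, hC, by rw [hT.verts]; exact hxs⟩

/-- The odd cycles among the orbits of a permutation moving along edges. -/
theorem exists_odd_trajectories (hσ : ∀ x ∈ σ.support, G.Adj x (σ x)) :
    ∃ (n : ℕ) (C : Fin n → G.Subgraph) (s : Fin n → Finset V),
      (∀ i, C i ∈ cycleSubgraphs G) ∧ (∀ i, IsTrajectory (C i) σ (s i)) ∧ (∀ i, Odd (s i).card) ∧
      (∀ i j, i ≠ j → Disjoint (C i).verts (C j).verts) ∧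
      σ.support.card ≤ 2 * matchingNumber G + n := by
  set F := σ.cycleFactorsFinset with hF
  have hon : ∀ f ∈ F, σ.IsCycleOn (f.support : Set V) := fun f hf =>
    Equiv.Perm.isCycleOn_support_of_mem_cycleFactorsFinset hf
  have hcyc : ∀ f ∈ F, f.IsCycle := fun f hf => (Equiv.Perm.mem_cycleFactorsFinset_iff.1 hf).1
  have hadj : ∀ f ∈ F, ∀ x ∈ f.support, G.Adj x (σ x) := fun f hf x hx =>
    hσ x (Equiv.Perm.mem_cycleFactorsFinset_support_le hf hx)
  have hdis : ∀ f ∈ F, ∀ g ∈ F, f ≠ g → Disjoint f.support g.support := fun f hf g hg hfg =>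
    Equiv.Perm.disjoint_iff_disjoint_support.1
      (Equiv.Perm.cycleFactorsFinset_pairwise_disjoint σ hf hg hfg)
  have hsum : ∑ f ∈ F, f.support.card = σ.support.card := by
    rw [← Equiv.Perm.sum_cycleType, Equiv.Perm.cycleType_def]
    rfl
  have hz : ∀ f : F, ∃ z, z ∈ f.1.support := fun f => (hcyc f f.2).nonempty_support
  choose z hz using hz
  have hM : IsEdgeMatching G (fun p : (Σ f : F, Fin (f.1.support.card / 2)) =>
      orbitEdge σ (z p.1) p.2) := by
    refine ⟨fun p => orbitEdge_mem_edgeSet (hon _ p.1.2) (hadj _ p.1.2) (hz _) _, ?_⟩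
    rintro ⟨f, i⟩ ⟨g, j⟩ x hx hy
    simp only at hx hy
    have h1 := mem_of_mem_orbitEdge (hon _ f.2) (hz f) hx
    have h2 := mem_of_mem_orbitEdge (hon _ g.2) (hz g) hy
    have hfg : f = g := by
      by_contra hne
      exact Finset.disjoint_left.1 (hdis f f.2 g g.2 fun h => hne (Subtype.ext h)) h1 h2
    subst hfg
    have := orbitEdge_disjoint (hon _ f.2) (hz f) i.2 j.2 hx hy
    rw [Fin.ext this]
  have hcard := hM.card_le
  simp only [Fintype.card_sigma, Fintype.card_fin] at hcard
  rw [Finset.sum_coe_sort F (fun f => f.support.card / 2)] at hcard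
  set O := F.filter fun f => Odd f.support.card with hO
  have hOF : ∀ f ∈ O, f ∈ F ∧ Odd f.support.card := fun f hf => Finset.mem_filter.1 hf
  -- An orbit of length k gives ⌊k/2⌋ matching edges, with one vertex left over exactly when k is
  -- odd.
  have hsplit : ∑ f ∈ F, f.support.card = 2 * ∑ f ∈ F, f.support.card / 2 + O.card := by
    rw [hO, Finset.card_filter, Finset.mul_sum, ← Finset.sum_add_distrib]
    refine Finset.sum_congr rfl fun f _ => ?_
    split_ifs with h
    · obtain ⟨k, hk⟩ := h; omega
    · obtain ⟨k, hk⟩ := Nat.not_odd_iff_even.1 h; omega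
  have horb : ∀ f ∈ O, IsCyclicOrbit G σ f.support := by
    intro f hf
    refine ⟨hon f (hOF f hf).1, ?_, hadj f (hOF f hf).1⟩
    have h2 := (hcyc f (hOF f hf).1).two_le_card_support
    obtain ⟨k, hk⟩ := (hOF f hf).2
    omega
  choose C hC hT using fun f : O => (horb f f.2).exists_isTrajectory
  refine ⟨O.card, fun i => C (O.equivFin.symm i), fun i => (O.equivFin.symm i).1.support,
    fun i => hC _, fun i => hT _, fun i => (hOF _ (O.equivFin.symm i).2).2, ?_, by omega⟩
  intro i j hij
  rw [(hT _).verts, (hT _).verts, Finset.disjoint_coe]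
  exact hdis _ (hOF _ (O.equivFin.symm i).2).1 _ (hOF _ (O.equivFin.symm j).2).1
    fun h => hij (O.equivFin.symm.injective (Subtype.ext h))

theorem card_support_le (hG : G.Connected) (hσ : ∀ x ∈ σ.support, G.Adj x (σ x)) :
    (σ.support.card : ℤ) ≤ 2 * matchingNumber G + cyclomaticNumber G := by
  obtain ⟨n, C, s, hC, hT, hodd, hd, hle⟩ := exists_odd_trajectories hσ
  have := card_le_cyclomaticNumber hG hC hd
  rw [Fintype.card_fin] at this
  omega

/-- The bound on the support forces as many odd orbits as the cyclomatic number, and then no cycle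
of G is missed by `exists_eq_of_card_eq`. -/
theorem cycles_of_le_card_support (hG : G.Connected) (hσ : ∀ x ∈ σ.support, G.Adj x (σ x))
    (hle : 2 * matchingNumber G + cyclomaticNumber G ≤ (σ.support.card : ℤ)) :
    (cycleSubgraphs G).PairwiseDisjoint SimpleGraph.Subgraph.verts ∧
      ∀ D ∈ cycleSubgraphs G, ∃ s, IsTrajectory D σ s ∧ Odd s.card := by
  obtain ⟨n, C, s, hC, hT, hodd, hd, hle'⟩ := exists_odd_trajectories hσ
  have h1 := card_le_cyclomaticNumber hG hC hd
  have h2 : (Fintype.card (Fin n) : ℤ) = cyclomaticNumber G := by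
    rw [Fintype.card_fin] at h1 ⊢
    omega
  refine ⟨?_, fun D hD => ?_⟩
  · intro D hD E hE hDE
    obtain ⟨i, rfl⟩ := exists_eq_of_card_eq hG hC hd h2 hD
    obtain ⟨j, rfl⟩ := exists_eq_of_card_eq hG hC hd h2 hE
    exact hd i j fun h => hDE (by rw [h])
  · obtain ⟨i, rfl⟩ := exists_eq_of_card_eq hG hC hd h2 hD
    exact ⟨s i, hT i, hodd i⟩

/-- Turns a nonzero term of a principal minor into a permutation of V. The support is all of S
because G has no loops. -/
theorem exists_extension {S : Finset V} (τ : Equiv.Perm {x // x ∈ S})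
    (hτ : ∀ i : {x // x ∈ S}, G.Adj i (τ i)) :
    ∃ σ : Equiv.Perm V, σ.support = S ∧ (∀ x ∈ σ.support, G.Adj x (σ x)) ∧
      ∀ i : {x // x ∈ S}, σ i = τ i := by
  have h1 : ∀ i : {x // x ∈ S}, Equiv.Perm.ofSubtype τ i = τ i := fun i =>
    Equiv.Perm.ofSubtype_apply_coe τ i
  have h2 : (Equiv.Perm.ofSubtype τ).support = S := by
    ext x
    rw [Equiv.Perm.mem_support]
    by_cases hx : x ∈ S
    · have := h1 ⟨x, hx⟩
      simp only at this
      rw [this]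
      exact iff_of_true (hτ ⟨x, hx⟩).ne' hx
    · simp [hx, Equiv.Perm.ofSubtype_apply_of_not_mem τ hx]
  refine ⟨Equiv.Perm.ofSubtype τ, h2, ?_, h1⟩
  intro x hx
  rw [h2] at hx
  have := hτ ⟨x, hx⟩
  rwa [← h1] at this

end Perm

/-- If the cycles are pairwise disjoint, then they have no chords. -/
theorem adj_of_mem_cycle (hd : (cycleSubgraphs G).PairwiseDisjoint SimpleGraph.Subgraph.verts)
    {C : G.Subgraph} (hC : C ∈ cycleSubgraphs G) {x y : V} (hx : x ∈ C.verts) (hy : y ∈ C.verts)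
    (hxy : G.Adj x y) : C.Adj x y := by
  by_contra hnot
  -- A chord would close, with a detour through C, to a second cycle meeting C.
  have hreach : (G.deleteEdges {s(x, y)}).Reachable x y := by
    refine (reachable_of_mem_cycle hC hx hy).mono fun a b hab => ?_
    refine SimpleGraph.deleteEdges_adj.2 ⟨C.adj_sub hab, fun h => hnot ?_⟩
    rw [← SimpleGraph.Subgraph.mem_edgeSet, ← Set.mem_singleton_iff.1 h]
    exact hab
  obtain ⟨u, p, hp, hmem⟩ := SimpleGraph.adj_and_reachable_delete_edges_iff_exists_cycle.1
    ⟨hxy, hreach⟩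
  have hD : p.toSubgraph ∈ cycleSubgraphs G := ⟨u, p, hp, rfl⟩
  have hDxy : p.toSubgraph.Adj x y := p.mem_edges_toSubgraph.2 hmem
  have hne : C ≠ p.toSubgraph := fun h => hnot (h ▸ hDxy)
  exact Set.disjoint_left.1 (hd hC hD hne) hx (p.toSubgraph.edge_vert hDxy)

end GainGraph

/-! ### Principal minors of Hermitian matrices; determinants of odd cycles -/

namespace GainGraph

section Matrix

open scoped Matrix

variable {n : Type*} [Fintype n] [DecidableEq n]

theorem card_le_rank_of_det_ne_zero {A : Matrix n n ℂ} {S : Finset n}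
    (h : (A.submatrix (Subtype.val : {x // x ∈ S} → n) Subtype.val).det ≠ 0) :
    S.card ≤ A.rank := by
  have h1 := Matrix.rank_of_det_ne_zero h
  have h2 := Matrix.rank_submatrix_le A (Subtype.val : {x // x ∈ S} → n)
    (Subtype.val : {x // x ∈ S} → n)
  rw [h1, Fintype.card_coe] at h2
  exact h2

/-- The rank of a Hermitian matrix is attained by a principal minor. -/
theorem exists_principal_minor {A : Matrix n n ℂ} (hA : A.IsHermitian) :
    ∃ S : Finset n, S.card = A.rank ∧
      (A.submatrix (Subtype.val : {x // x ∈ S} → n) Subtype.val).det ≠ 0 := by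
  obtain ⟨κ, a, ha, hspan, hli⟩ := exists_linearIndependent' ℂ A.row
  have : Finite κ := Finite.of_injective a ha
  have : Fintype κ := Fintype.ofFinite κ
  have : DecidableEq κ := Classical.decEq κ
  set B := A.submatrix a id with hB
  have hliB : LinearIndependent ℂ B.row := hli
  have hrank : A.rank = Fintype.card κ := by
    rw [Matrix.rank_eq_finrank_span_row, ← hspan]
    exact finrank_span_eq_card hli
  have hrow : ∀ i, ∃ c : κ → ℂ, ∑ k, c k • A (a k) = A i := by
    intro i
    have : A.row i ∈ Submodule.span ℂ (Set.range (A.row ∘ a)) := by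
      rw [hspan]
      exact Submodule.subset_span ⟨i, rfl⟩
    exact (Submodule.mem_span_range_iff_exists_fun ℂ).1 this
  choose P hP using hrow
  have hAP : A = Matrix.of P * B := by
    ext i j
    rw [← hP i]
    simp [Matrix.mul_apply, hB]
  -- The rows of B form a basis of the row space, so A = PB. Since A is Hermitian, B = A[a,a]Pᴴ, and
  -- a left kernel vector of A[a,a] would be a relation between the rows of B.
  have hdet : (A.submatrix a a).det ≠ 0 := by
    intro h0
    obtain ⟨w, hw, hw0⟩ := Matrix.exists_vecMul_eq_zero_iff.2 h0
    have hBfac : B = A.submatrix a a * (Matrix.of P)ᴴ := by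
      have h1 : A = Bᴴ * (Matrix.of P)ᴴ := by
        conv_lhs => rw [← hA.eq, hAP]
        rw [Matrix.conjTranspose_mul]
      have h2 : Bᴴ.submatrix a id = A.submatrix a a := by
        ext i j
        simp only [hB, Matrix.submatrix_apply, Matrix.conjTranspose_apply, id]
        exact hA.apply _ _
      ext i j
      have h3 := congrFun (congrFun h1 (a i)) j
      rw [← h2]
      simpa [hB, Matrix.mul_apply] using h3
    have hinj := Matrix.vecMul_injective_iff.2 hliB
    refine hw (hinj ?_)
    simp only [Matrix.zero_vecMul]
    rw [hBfac, ← Matrix.vecMul_vecMul, hw0, Matrix.zero_vecMul]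
  let S : Finset n := Finset.univ.image a
  let f : κ ≃ {x // x ∈ S} := Equiv.ofBijective (fun k => ⟨a k, by simp [S]⟩)
    ⟨fun i j h => ha (congrArg Subtype.val h), by
      rintro ⟨x, hx⟩
      obtain ⟨k, -, rfl⟩ := Finset.mem_image.1 hx
      exact ⟨k, rfl⟩⟩
  refine ⟨S, ?_, ?_⟩
  · rw [hrank, Finset.card_image_of_injective _ ha, Finset.card_univ]
  · rw [← Matrix.det_submatrix_equiv_self f]
    exact hdet

theorem det_eq_sum (A : Matrix n n ℂ) :
    A.det = ∑ σ : Equiv.Perm n, ((Equiv.Perm.sign σ : ℤ) : ℂ) * ∏ i, A i (σ i) := by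
  rw [← Matrix.det_transpose, Matrix.det_apply']
  rfl

theorem exists_perm_of_det_ne_zero {A : Matrix n n ℂ} (h : A.det ≠ 0) :
    ∃ σ : Equiv.Perm n, ∀ i, A i (σ i) ≠ 0 := by
  rw [det_eq_sum] at h
  obtain ⟨σ, -, hσ⟩ := Finset.exists_ne_zero_of_sum_ne_zero h
  exact ⟨σ, fun i => Finset.prod_ne_zero_iff.1 (right_ne_zero_of_mul hσ) i (Finset.mem_univ i)⟩

/-- Deleting entries that occur in no nonzero term of the expansion keeps the determinant. -/
theorem det_congr {A B : Matrix n n ℂ} (hB : ∀ i j, A i j = 0 → B i j = 0)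
    (h : ∀ σ : Equiv.Perm n, (∀ i, A i (σ i) ≠ 0) → ∀ i, B i (σ i) = A i (σ i)) :
    B.det = A.det := by
  rw [det_eq_sum, det_eq_sum]
  refine Finset.sum_congr rfl fun σ _ => ?_
  congr 1
  by_cases hσ : ∀ i, A i (σ i) ≠ 0
  · exact Finset.prod_congr rfl fun i _ => h σ hσ i
  · push Not at hσ
    obtain ⟨i, hi⟩ := hσ
    have hBi : B i (σ i) = 0 := hB _ _ hi
    rw [Finset.prod_eq_zero (f := fun i => B i (σ i)) (Finset.mem_univ i) hBi,
      Finset.prod_eq_zero (f := fun i => A i (σ i)) (Finset.mem_univ i) hi]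

/-- A permutation moving along an odd cycle is one of its two rotations. -/
theorem eq_or_eq_inv_of_odd {ρ σ : Equiv.Perm n}
    (hρ : ρ.IsCycleOn ((Finset.univ : Finset n) : Set n))
    (h3 : 3 ≤ Fintype.card n) (hodd : Odd (Fintype.card n))
    (hσ : ∀ i, σ i = ρ i ∨ i = ρ (σ i)) : σ = ρ ∨ σ = ρ⁻¹ := by
  by_cases hex : ∃ z, σ z = ρ z
  · left
    obtain ⟨z, hz⟩ := hex
    have hne : ∀ i, ρ (ρ i) ≠ i := by
      intro i h
      have h2 : (ρ ^ 2) i = i := by rwa [pow_two, Equiv.Perm.mul_apply]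
      have h4 := Nat.le_of_dvd (by omega) ((hρ.pow_apply_eq (Finset.mem_univ i)).1 h2)
      rw [Finset.card_univ] at h4
      omega
    -- At ρ² i the permutation σ cannot step back to ρ i, which is already the image of i.
    have hstep : ∀ i, σ i = ρ i → σ (ρ (ρ i)) = ρ (ρ (ρ i)) := by
      intro i hi
      rcases hσ (ρ (ρ i)) with h | h
      · exact h
      · have h1 := ρ.injective h
        rw [← hi] at h1
        exact absurd (σ.injective h1).symm (by rw [hi]; exact hne i)
    have hiter : ∀ (k : ℕ) i, σ i = ρ i → σ ((ρ ^ (2 * k)) i) = ρ ((ρ ^ (2 * k)) i) := by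
      intro k
      induction k with
      | zero => intro i hi; simpa using hi
      | succ k ih =>
        intro i hi
        have := hstep _ (ih i hi)
        have h1 : (ρ ^ (2 * (k + 1))) i = ρ (ρ ((ρ ^ (2 * k)) i)) := by
          rw [show 2 * (k + 1) = 2 * k + 1 + 1 by ring, pow_succ', pow_succ']
          rfl
        rwa [h1]
    have hall := subset_of_forall_apply_mem hρ (t := {i | σ i = ρ i}) (Finset.mem_univ z) hz (by
      intro i _ hi
      -- With n = 2k + 1 points, 2(k + 1) = n + 1 steps of ρ amount to a single step, so agreement
      -- spreads to the whole orbit.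
      obtain ⟨k, hk⟩ := hodd
      have h1 := hiter (k + 1) i hi
      have h2 : (ρ ^ (2 * (k + 1))) i = ρ i := by
        rw [show 2 * (k + 1) = Fintype.card n + 1 by omega, pow_succ', Equiv.Perm.mul_apply,
          ← Finset.card_univ, hρ.pow_card_apply (Finset.mem_univ i)]
      rw [h2] at h1
      exact h1)
    ext i
    exact hall i (Finset.mem_univ i)
  · right
    push Not at hex
    ext i
    rw [Equiv.Perm.eq_inv_iff_eq]
    exact ((hσ i).resolve_left (hex i)).symm

/-- Only the two rotations ρ and ρ⁻¹ contribute, and they have equal sign. -/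
theorem det_odd_cycle {A : Matrix n n ℂ} {ρ : Equiv.Perm n}
    (hρ : ρ.IsCycleOn ((Finset.univ : Finset n) : Set n))
    (h3 : 3 ≤ Fintype.card n) (hodd : Odd (Fintype.card n))
    (hA : ∀ i j, A i j ≠ 0 → j = ρ i ∨ i = ρ j) :
    A.det = ((Equiv.Perm.sign ρ : ℤ) : ℂ) * (∏ i, A i (ρ i) + ∏ i, A (ρ i) i) := by
  have hne : ρ ≠ ρ⁻¹ := by
    intro h
    obtain ⟨i⟩ : Nonempty n := Fintype.card_pos_iff.1 (by omega)
    have h2 : (ρ ^ 2) i = i := by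
      rw [pow_two, Equiv.Perm.mul_apply]
      nth_rw 1 [h]
      simp
    have h4 := Nat.le_of_dvd (by omega) ((hρ.pow_apply_eq (Finset.mem_univ i)).1 h2)
    rw [Finset.card_univ] at h4
    omega
  rw [det_eq_sum, ← Finset.sum_subset (Finset.subset_univ {ρ, ρ⁻¹}), Finset.sum_pair hne,
    Equiv.Perm.sign_inv, mul_add]
  · congr 2
    rw [← Equiv.prod_comp ρ]
    simp
  · intro σ _ hσ
    have : ∃ i, A i (σ i) = 0 := by
      by_contra! h
      exact hσ (by simpa using eq_or_eq_inv_of_odd hρ h3 hodd fun i => hA _ _ (h i))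
    obtain ⟨i, hi⟩ := this
    rw [Finset.prod_eq_zero (Finset.mem_univ i) hi, mul_zero]

end Matrix

variable {V : Type*} {G : SimpleGraph V} (φ : UnitGain G)

theorem adjMatrix_ne_zero_iff {x y : V} : φ.adjMatrix x y ≠ 0 ↔ G.Adj x y := by
  by_cases h : G.Adj x y
  · simp [UnitGain.adjMatrix, h]
  · simp [UnitGain.adjMatrix, h]

theorem isHermitian_adjMatrix : φ.adjMatrix.IsHermitian := by
  ext x y
  rw [Matrix.conjTranspose_apply]
  by_cases h : G.Adj x y
  · have h' := h.symm
    have := φ.gain_symm ⟨(x, y), h⟩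
    have h2 : (⟨(x, y), h⟩ : G.Dart).symm = ⟨(y, x), h'⟩ := rfl
    rw [h2] at this
    simp only [UnitGain.adjMatrix, Matrix.of_apply, dif_pos h, dif_pos h', this,
      Circle.coe_inv_eq_conj]
    simp
  · have h' : ¬ G.Adj y x := fun h' => h h'.symm
    simp [UnitGain.adjMatrix, h, h']

theorem adjMatrix_mul_symm {x y : V} (h : G.Adj x y) :
    φ.adjMatrix x y * φ.adjMatrix y x = 1 := by
  rw [← (isHermitian_adjMatrix φ).apply y x]
  simp only [UnitGain.adjMatrix, Matrix.of_apply, dif_pos h]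
  rw [Complex.star_def, Complex.mul_conj, Circle.normSq_coe]
  simp

/-- A chordless odd cycle is nonsingular iff its gain has nonzero real part. -/
theorem det_cycle_ne_zero_iff [DecidableEq V] {C : G.Subgraph} {σ : Equiv.Perm V} {s : Finset V}
    (hT : IsTrajectory C σ s) (hodd : Odd s.card)
    (hind : ∀ x ∈ C.verts, ∀ y ∈ C.verts, G.Adj x y → C.Adj x y) :
    (φ.adjMatrix.submatrix (Subtype.val : {x // x ∈ s} → V) Subtype.val).det ≠ 0 ↔
      (∏ x ∈ s, φ.adjMatrix x (σ x)).re ≠ 0 := by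
  have hmem : ∀ x, σ x ∈ s ↔ x ∈ s := fun x => by
    exact_mod_cast hT.isCycleOn.apply_mem_iff (x := x)
  let ρ : Equiv.Perm {x // x ∈ s} := σ.subtypePerm hmem
  have hρ : ρ.IsCycleOn ((Finset.univ : Finset {x // x ∈ s}) : Set {x // x ∈ s}) := by
    have := hT.isCycleOn.subtypePerm
    rw [Finset.coe_univ]
    exact this
  have hval : ∀ i, ((ρ i : {x // x ∈ s}) : V) = σ i := fun i => rfl
  rw [det_odd_cycle hρ (by rw [Fintype.card_coe]; exact hT.three_le)
    (by rw [Fintype.card_coe]; exact hodd)]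
  · have h1 : ∏ i, (φ.adjMatrix.submatrix (Subtype.val : {x // x ∈ s} → V) Subtype.val) i (ρ i) =
        ∏ x ∈ s, φ.adjMatrix x (σ x) := by
      simp only [Matrix.submatrix_apply, hval]
      exact Finset.prod_coe_sort s fun x => φ.adjMatrix x (σ x)
    have h2 : ∏ i, (φ.adjMatrix.submatrix (Subtype.val : {x // x ∈ s} → V) Subtype.val) (ρ i) i =
        (starRingEnd ℂ) (∏ x ∈ s, φ.adjMatrix x (σ x)) := by
      simp only [Matrix.submatrix_apply, hval, map_prod]
      rw [← Finset.prod_coe_sort s]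
      refine Finset.prod_congr rfl fun i _ => ?_
      exact ((isHermitian_adjMatrix φ).apply _ _).symm
    -- The two rotations give conjugate products, so their sum is twice the real part.
    rw [h1, h2, Complex.add_conj]
    have h3 : ((Equiv.Perm.sign ρ : ℤ) : ℂ) ≠ 0 := by
      exact_mod_cast (Equiv.Perm.sign ρ).ne_zero
    simp [h3]
  · intro i j hij
    have hadj := (adjMatrix_ne_zero_iff φ).1 hij
    have hv : ∀ k : {x // x ∈ s}, (k : V) ∈ C.verts := fun k => by rw [hT.verts]; exact k.2
    rcases (hT.adj_iff _ _).1 (hind _ (hv i) _ (hv j) hadj) with ⟨-, h⟩ | ⟨-, h⟩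
    · exact Or.inl (Subtype.ext h)
    · exact Or.inr (Subtype.ext h)

end GainGraph

/-! ### Matchings of G, of T_G and of G - O(G) -/

namespace GainGraph

variable {V : Type*} {G : SimpleGraph V}

/-- For disjoint cycles, lying on a common cycle is already transitive; generating the equivalence
only adds reflexivity. -/
theorem eq_or_mem_cycle_of_mk_eq
    (hd : (cycleSubgraphs G).PairwiseDisjoint SimpleGraph.Subgraph.verts) {x y : V}
    (h : Quotient.mk (cycleSetoid G) x = Quotient.mk (cycleSetoid G) y) :
    x = y ∨ ∃ C ∈ cycleSubgraphs G, x ∈ C.verts ∧ y ∈ C.verts := by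
  have h' : (cycleSetoid G) x y := Quotient.exact h
  clear h
  induction h' with
  | rel x y h => exact Or.inr h
  | refl => exact Or.inl rfl
  | symm x y _ ih =>
    rcases ih with h | ⟨C, hC, h1, h2⟩
    · exact Or.inl h.symm
    · exact Or.inr ⟨C, hC, h2, h1⟩
  | trans x y z _ _ ih1 ih2 =>
    rcases ih1 with rfl | ⟨C, hC, h1, h2⟩
    · exact ih2
    · rcases ih2 with rfl | ⟨D, hD, h3, h4⟩
      · exact Or.inr ⟨C, hC, h1, h2⟩
      · have : C = D := by
          by_contra hne
          exact Set.disjoint_left.1 (hd hC hD hne) h2 h3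
        subst this
        exact Or.inr ⟨C, hC, h1, h4⟩

theorem eq_of_mk_eq_of_notMem {x y : V} (hx : x ∉ cycleVertices G)
    (h : Quotient.mk (cycleSetoid G) x = Quotient.mk (cycleSetoid G) y) : x = y := by
  have h' : (cycleSetoid G) x y := Quotient.exact h
  have key : x = y ∨ (x ∈ cycleVertices G ∧ y ∈ cycleVertices G) := by
    clear h hx
    induction h' with
    | rel x y h =>
      obtain ⟨C, hC, h1, h2⟩ := h
      exact Or.inr ⟨mem_cycleVertices.2 ⟨C, hC, h1⟩, mem_cycleVertices.2 ⟨C, hC, h2⟩⟩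
    | refl => exact Or.inl rfl
    | symm x y _ ih => exact ih.imp Eq.symm And.symm
    | trans x y z _ _ ih1 ih2 =>
      rcases ih1 with rfl | ⟨h1, h2⟩
      · exact ih2
      · rcases ih2 with rfl | ⟨h3, h4⟩
        · exact Or.inr ⟨h1, h2⟩
        · exact Or.inr ⟨h1, h4⟩
  exact key.resolve_right fun h => hx h.1

/-- A matching of `G - O(G)` is a matching of `G` avoiding the cycles. -/
theorem exists_isEdgeMatching_avoiding [Finite V] (G : SimpleGraph V) :
    ∃ e : Fin (matchingNumber (G.induce (cycleVertices G)ᶜ)) → Sym2 V,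
      IsEdgeMatching G e ∧ ∀ i, ∀ x ∈ e i, x ∉ cycleVertices G := by
  obtain ⟨e, he⟩ := exists_isEdgeMatching (G.induce (cycleVertices G)ᶜ)
  refine ⟨fun i => (e i).map Subtype.val, ⟨fun i => ?_, ?_⟩, ?_⟩
  · have := he.1 i
    beta_reduce
    generalize e i = p at this ⊢
    induction p with | _ x y => exact this
  · intro i j x hi hj
    obtain ⟨a, ha, rfl⟩ := Sym2.mem_map.1 hi
    obtain ⟨b, hb, hab⟩ := Sym2.mem_map.1 hj
    obtain rfl : b = a := Subtype.ext hab
    exact he.2 ha hb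
  · intro i x hx
    obtain ⟨a, ha, rfl⟩ := Sym2.mem_map.1 hx
    exact a.2

theorem map_mk_mem_edgeSet {p : Sym2 V} (hp : p ∈ G.edgeSet) {x : V} (hx : x ∈ p)
    (hxO : x ∉ cycleVertices G) :
    p.map (Quotient.mk (cycleSetoid G)) ∈ (contractCycles G).edgeSet := by
  obtain ⟨y, rfl⟩ := Sym2.mem_iff_exists.1 hx
  have hxy : G.Adj x y := hp
  exact ⟨fun h => hxy.ne (eq_of_mk_eq_of_notMem hxO h), x, y, hxy, rfl, rfl⟩

/-- The half of condition (iii) that always holds: vertices off the cycles are alone in their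
classes. -/
theorem matchingNumber_induce_le [Finite V] :
    matchingNumber (G.induce (cycleVertices G)ᶜ) ≤ matchingNumber (contractCycles G) := by
  obtain ⟨e, he, hO⟩ := exists_isEdgeMatching_avoiding G
  have hM : IsEdgeMatching (contractCycles G)
      (fun i => (e i).map (Quotient.mk (cycleSetoid G))) := by
    refine ⟨fun i => map_mk_mem_edgeSet (he.1 i) (Sym2.out_fst_mem _)
      (hO i _ (Sym2.out_fst_mem _)), ?_⟩
    intro i j x hi hj
    obtain ⟨a, ha, rfl⟩ := Sym2.mem_map.1 hi
    obtain ⟨b, hb, hab⟩ := Sym2.mem_map.1 hj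
    obtain rfl := eq_of_mk_eq_of_notMem (hO j b hb) hab
    exact he.2 ha hb
  have := hM.card_le
  rwa [Fintype.card_fin] at this

section Counting

variable {σ : cycleSubgraphs G → Equiv.Perm V} {s : cycleSubgraphs G → Finset V}

theorem disjoint_of_ne (hd : (cycleSubgraphs G).PairwiseDisjoint SimpleGraph.Subgraph.verts)
    (hT : ∀ C : cycleSubgraphs G, IsTrajectory (C : G.Subgraph) (σ C) (s C))
    {C D : cycleSubgraphs G} (h : C ≠ D) :
    Disjoint (s C) (s D) := by
  have := hd C.2 D.2 fun h' => h (Subtype.ext h')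
  rw [Function.onFun, (hT C).verts, (hT D).verts] at this
  exact_mod_cast this

theorem mem_cycleVertices_iff
    (hT : ∀ C : cycleSubgraphs G, IsTrajectory (C : G.Subgraph) (σ C) (s C)) {x : V} :
    x ∈ cycleVertices G ↔ ∃ C, x ∈ s C := by
  rw [mem_cycleVertices]
  constructor
  · rintro ⟨C, hC, hx⟩
    refine ⟨⟨C, hC⟩, ?_⟩
    have := (hT ⟨C, hC⟩).verts
    simp only at this
    rw [this] at hx
    exact hx
  · rintro ⟨C, hx⟩
    exact ⟨C, C.2, by rw [(hT C).verts]; exact hx⟩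

variable [Fintype (cycleSubgraphs G)]

/-- The number of vertices on pairwise disjoint odd cycles. -/
theorem ncard_cycleVertices
    (hd : (cycleSubgraphs G).PairwiseDisjoint SimpleGraph.Subgraph.verts)
    (hT : ∀ C : cycleSubgraphs G, IsTrajectory (C : G.Subgraph) (σ C) (s C))
    (hodd : ∀ C, Odd (s C).card) :
    (cycleVertices G).ncard = 2 * ∑ C, (s C).card / 2 + Fintype.card (cycleSubgraphs G) := by
  classical
  have h1 : cycleVertices G = ((Finset.univ.biUnion s : Finset V) : Set V) := by
    ext x
    rw [mem_cycleVertices_iff hT]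
    simp
  rw [h1, Set.ncard_coe_finset, Finset.card_biUnion fun C _ D _ h => disjoint_of_ne hd hT h,
    Finset.mul_sum, ← Finset.card_univ, Finset.card_eq_sum_ones, ← Finset.sum_add_distrib]
  refine Finset.sum_congr rfl fun C _ => ?_
  obtain ⟨k, hk⟩ := hodd C
  omega

variable [Fintype V]

/-- A matching of the contracted graph extends by near-perfect matchings of the odd cycles. -/
theorem matchingNumber_contractCycles_add_le
    (hd : (cycleSubgraphs G).PairwiseDisjoint SimpleGraph.Subgraph.verts)
    (hT : ∀ C : cycleSubgraphs G, IsTrajectory (C : G.Subgraph) (σ C) (s C))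
    (hodd : ∀ C, Odd (s C).card) :
    matchingNumber (contractCycles G) + ∑ C, (s C).card / 2 ≤ matchingNumber G := by
  obtain ⟨f, hf⟩ := exists_isEdgeMatching (contractCycles G)
  have hlift : ∀ k, ∃ g ∈ G.edgeSet, g.map (Quotient.mk (cycleSetoid G)) = f k := by
    intro k
    have := hf.1 k
    generalize f k = p at this ⊢
    induction p with | _ a b => ?_
    obtain ⟨-, u, v, huv, rfl, rfl⟩ := this
    exact ⟨s(u, v), huv, rfl⟩
  choose g hg hgf using hlift
  have hmem : ∀ k x, x ∈ g k → Quotient.mk (cycleSetoid G) x ∈ f k := fun k x hx => by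
    rw [← hgf k]
    exact Sym2.mem_map.2 ⟨x, hx, rfl⟩
  have hmk : ∀ C x y, x ∈ s C → y ∈ s C →
      Quotient.mk (cycleSetoid G) x = Quotient.mk (cycleSetoid G) y := fun C x y hx hy =>
    mk_eq_of_mem_cycle C.2 (by rw [(hT C).verts]; exact hx) (by rw [(hT C).verts]; exact hy)
  -- A cycle is one vertex of T_G, so at most one lifted edge meets it, and in a single vertex z,
  -- since an edge inside the cycle would contract to a loop. An unmatched cycle gets an arbitrary
  -- z.
  have hz : ∀ C, ∃ z ∈ s C, ∀ k, ∀ x ∈ g k, x ∈ s C → x = z := by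
    intro C
    by_cases h : ∃ k, ∃ z ∈ g k, z ∈ s C
    · obtain ⟨k, z, hz, hzs⟩ := h
      refine ⟨z, hzs, fun k' x hx hxs => ?_⟩
      have h1 := hmem k z hz
      have h2 := hmem k' x hx
      rw [hmk C x z hxs hzs] at h2
      obtain rfl := hf.2 h1 h2
      by_contra hne
      have h3 : g k = s(x, z) := (Sym2.mem_and_mem_iff hne).1 ⟨hx, hz⟩
      have h4 := hf.1 k
      rw [← hgf k, h3, Sym2.map_mk] at h4
      have h5 : (contractCycles G).Adj (Quotient.mk _ x) (Quotient.mk _ z) := h4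
      exact h5.ne (hmk C x z hxs hzs)
    · push Not at h
      obtain ⟨z, hz⟩ : (s C).Nonempty := Finset.card_pos.1 (by have := (hT C).three_le; omega)
      exact ⟨z, hz, fun k x hx hxs => absurd hxs (h k x hx)⟩
  choose z hzs hz using hz
  have hM : IsEdgeMatching G (Sum.elim g
      (fun p : (Σ C, Fin ((s C).card / 2)) => orbitEdge (σ p.1) (z p.1) p.2)) := by
    have hmix : ∀ k C (i : Fin ((s C).card / 2)) x, x ∈ g k → x ∈ orbitEdge (σ C) (z C) i →
        False := by
      intro k C i x hx hxi
      obtain rfl := hz C k x hx (mem_of_mem_orbitEdge (hT C).isCycleOn (hzs C) hxi)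
      exact notMem_orbitEdge_of_odd (hT C).isCycleOn (hzs C) i.2 (hodd C) hxi
    refine ⟨?_, ?_⟩
    · rintro (k | ⟨C, i⟩)
      · exact hg k
      · exact orbitEdge_mem_edgeSet (hT C).isCycleOn (hT C).adj (hzs C) _
    · rintro (k | ⟨C, i⟩) (k' | ⟨D, j⟩) x hx hy
      · exact congrArg _ (hf.2 (hmem k x hx) (hmem k' x hy))
      · exact (hmix k D j x hx hy).elim
      · exact (hmix k' C i x hy hx).elim
      · simp only [Sum.elim_inr] at hx hy
        have h1 := mem_of_mem_orbitEdge (hT C).isCycleOn (hzs C) hx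
        have h2 := mem_of_mem_orbitEdge (hT D).isCycleOn (hzs D) hy
        have hCD : C = D := by
          by_contra hne
          exact Finset.disjoint_left.1 (disjoint_of_ne hd hT hne) h1 h2
        subst hCD
        rw [Fin.ext (orbitEdge_disjoint (hT C).isCycleOn (hzs C) i.2 j.2 hx hy)]
  have := hM.card_le
  simpa using this

/-- If contracting the cycles does not create larger matchings than deleting them, then every
matching consists of few edges inside the cycles and few edges outside. -/
theorem matchingNumber_le_of_eq
    (hd : (cycleSubgraphs G).PairwiseDisjoint SimpleGraph.Subgraph.verts)
    (hT : ∀ C : cycleSubgraphs G, IsTrajectory (C : G.Subgraph) (σ C) (s C))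
    (hm : matchingNumber (contractCycles G) = matchingNumber (G.induce (cycleVertices G)ᶜ)) :
    matchingNumber G ≤ matchingNumber (contractCycles G) + ∑ C, (s C).card / 2 := by
  classical
  obtain ⟨K, hK, hcov⟩ := exists_cover_of_isAcyclic _ (isAcyclic_contractCycles (G := G))
  have hKfin : K.Finite := Set.toFinite K
  -- the cover consists of vertices outside the cycles
  have hKO : ∀ a ∈ K, ∃ x ∉ cycleVertices G, Quotient.mk (cycleSetoid G) x = a := by
    obtain ⟨e, he, hO⟩ := exists_isEdgeMatching_avoiding G
    have hpick : ∀ i, ∃ x ∈ e i, Quotient.mk (cycleSetoid G) x ∈ K := by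
      intro i
      have h1 := map_mk_mem_edgeSet (he.1 i) (Sym2.out_fst_mem _) (hO i _ (Sym2.out_fst_mem _))
      generalize e i = p at h1 ⊢
      induction p with | _ x y => ?_
      rcases hcov _ _ h1 with h | h
      · exact ⟨x, by simp, h⟩
      · exact ⟨y, by simp, h⟩
    choose x hx hxK using hpick
    have hinj : Function.Injective fun i => Quotient.mk (cycleSetoid G) (x i) := by
      intro i j hij
      have h1 := eq_of_mk_eq_of_notMem (hO i _ (hx i)) hij
      exact he.2 (hx i) (h1 ▸ hx j)
    -- Disjoint edges need distinct cover vertices. By `hm` the matching of G - O(G) has at least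
    -- |K| edges, so the chosen vertices exhaust K.
    have hrange : (Set.range fun i => Quotient.mk (cycleSetoid G) (x i)) = K := by
      refine Set.eq_of_subset_of_ncard_le (Set.range_subset_iff.2 hxK) ?_ hKfin
      rw [← Set.image_univ, Set.ncard_image_of_injective _ hinj, Set.ncard_univ, Nat.card_fin]
      omega
    intro a ha
    rw [← hrange] at ha
    obtain ⟨i, rfl⟩ := ha
    exact ⟨x i, hO i _ (hx i), rfl⟩
  obtain ⟨g, hg⟩ := exists_isEdgeMatching G
  let P : Fin (matchingNumber G) → Prop := fun k => ∃ x ∈ g k, x ∉ cycleVertices G ∧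
    Quotient.mk (cycleSetoid G) x ∈ K
  -- An edge of G without an end in the cover is contracted to a point, so it lies inside one cycle.
  have hcases : ∀ k, P k ∨ ∃ C, ∀ x ∈ g k, x ∈ s C := by
    intro k
    have h1 := hg.1 k
    by_cases hP : P k
    · exact Or.inl hP
    right
    have hKx : ∀ x ∈ g k, Quotient.mk (cycleSetoid G) x ∉ K := by
      intro x hx hxK
      obtain ⟨y, hy, hyx⟩ := hKO _ hxK
      obtain rfl := eq_of_mk_eq_of_notMem hy hyx
      exact hP ⟨y, hx, hy, hxK⟩
    generalize g k = p at h1 hKx ⊢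
    induction p with | _ x y => ?_
    have hxy : G.Adj x y := h1
    have heq : Quotient.mk (cycleSetoid G) x = Quotient.mk (cycleSetoid G) y := by
      by_contra hne
      rcases hcov _ _ (show (contractCycles G).Adj _ _ from ⟨hne, x, y, hxy, rfl, rfl⟩) with h | h
      · exact hKx x (by simp) h
      · exact hKx y (by simp) h
    rcases eq_or_mem_cycle_of_mk_eq hd heq with h | ⟨C, hC, hx, hy⟩
    · exact absurd h hxy.ne
    · refine ⟨⟨C, hC⟩, ?_⟩
      have hv := (hT ⟨C, hC⟩).verts
      simp only at hv
      rw [hv] at hx hy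
      intro z hz
      rcases Sym2.mem_iff.1 hz with rfl | rfl
      · exact hx
      · exact hy
  have hPcard : (Finset.univ.filter P).card ≤ K.ncard := by
    have hpick : ∀ k : {k // P k}, ∃ x ∈ g k, x ∉ cycleVertices G ∧
      Quotient.mk (cycleSetoid G) x ∈ K := fun k => k.2
    choose x hx hxO hxK using hpick
    have hinj : Function.Injective fun k => Quotient.mk (cycleSetoid G) (x k) := by
      intro i j hij
      have h1 := eq_of_mk_eq_of_notMem (hxO i) hij
      exact Subtype.ext (hg.2 (hx i) (h1 ▸ hx j))
    rw [← Fintype.card_subtype, ← Nat.card_eq_fintype_card, ← Set.ncard_univ,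
      ← Set.ncard_image_of_injective _ hinj, Set.image_univ]
    exact Set.ncard_le_ncard (Set.range_subset_iff.2 hxK) hKfin
  have hCcard : ∀ C, (Finset.univ.filter fun k => ∀ x ∈ g k, x ∈ s C).card ≤ (s C).card / 2 := by
    intro C
    have hM : IsEdgeMatching G (fun k : {k // ∀ x ∈ g k, x ∈ s C} => g k) :=
      ⟨fun k => hg.1 k, fun i j x hi hj => Subtype.ext (hg.2 hi hj)⟩
    have h1 := hM.ncard_covered
    have h2 : {x | ∃ i : {k // ∀ x ∈ g k, x ∈ s C}, x ∈ g i} ⊆ (s C : Set V) := by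
      rintro x ⟨i, hi⟩
      exact i.2 x hi
    have h3 := Set.ncard_le_ncard h2 (Finset.finite_toSet _)
    rw [h1, Set.ncard_coe_finset, Fintype.card_subtype] at h3
    omega
  have hunion : (Finset.univ : Finset (Fin (matchingNumber G))) ⊆ Finset.univ.filter P ∪
      Finset.univ.biUnion fun C => Finset.univ.filter fun k => ∀ x ∈ g k, x ∈ s C := by
    intro k _
    rcases hcases k with h | ⟨C, h⟩
    · exact Finset.mem_union_left _ (by simpa using h)
    · exact Finset.mem_union_right _ (Finset.mem_biUnion.2 ⟨C, Finset.mem_univ C, by simpa using h⟩)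
  have h1 := Finset.card_le_card hunion
  rw [Finset.card_univ, Fintype.card_fin] at h1
  have h2 := Finset.card_union_le (Finset.univ.filter P)
    (Finset.univ.biUnion fun C => Finset.univ.filter fun k => ∀ x ∈ g k, x ∈ s C)
  have h3 := (Finset.card_biUnion_le (s := Finset.univ)
    (t := fun C => Finset.univ.filter fun k => ∀ x ∈ g k, x ∈ s C)).trans
    (Finset.sum_le_sum fun C _ => hCcard C)
  omega

end Counting

end GainGraph

/-! ### Block decomposition of large minors; the two implications -/

namespace GainGraph

/-- Kernel vectors taken as functions on the whole index type allow minors on nested sets to be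
compared without reindexing. -/
theorem det_minor_ne_zero_iff {n : Type*} [DecidableEq n] {A : Matrix n n ℂ} {S : Finset n} :
    (A.submatrix (Subtype.val : {x // x ∈ S} → n) Subtype.val).det ≠ 0 ↔
      ∀ f : n → ℂ, (∀ x ∈ S, ∑ y ∈ S, A x y * f y = 0) → ∀ x ∈ S, f x = 0 := by
  rw [← not_iff_not, not_not, ← Matrix.exists_mulVec_eq_zero_iff]
  constructor
  · rintro ⟨g, hg, hg0⟩ h
    refine hg (funext fun x => ?_)
    have := h (fun y => if hy : y ∈ S then g ⟨y, hy⟩ else 0) (fun x hx => ?_) x x.2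
    · simpa using this
    · have h1 := congrFun hg0 ⟨x, hx⟩
      rw [← Finset.sum_coe_sort S]
      simpa [Matrix.mulVec, dotProduct] using h1
  · intro h
    push Not at h
    obtain ⟨f, hf, x, hx, hfx⟩ := h
    refine ⟨fun y => f y, fun h0 => hfx (congrFun h0 ⟨x, hx⟩), funext fun y => ?_⟩
    have h1 := hf y y.2
    rw [← Finset.sum_coe_sort S] at h1
    simpa [Matrix.mulVec, dotProduct] using h1

variable {V : Type*} {G : SimpleGraph V} [Fintype V] [DecidableEq V] (φ : UnitGain G)

/-- A vertex set avoiding all cycles and carrying a perfect matching has a nonzero principal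
minor. -/
theorem det_matched_ne_zero {S : Finset V} (hS : ∀ x ∈ S, x ∉ cycleVertices G)
    (τ₀ : Equiv.Perm {x // x ∈ S}) (hτ₀ : ∀ i : {x // x ∈ S}, G.Adj i (τ₀ i)) :
    (φ.adjMatrix.submatrix (Subtype.val : {x // x ∈ S} → V) Subtype.val).det ≠ 0 := by
  classical
  -- An orbit of length at least three would put a vertex of S on a cycle.
  have hinv : ∀ τ : Equiv.Perm {x // x ∈ S}, (∀ i : {x // x ∈ S}, G.Adj i (τ i)) →
      ∀ i, τ (τ i) = i := by
    intro τ hτ i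
    obtain ⟨σ, -, hσ, hστ⟩ := exists_extension τ hτ
    by_contra hne
    refine hS i i.2 (mem_cycleVertices_of_apply_apply_ne hσ fun h => hne (Subtype.ext ?_))
    rwa [hστ, hστ] at h
  -- Contributing permutations are fixed-point-free involutions: equal sign, and each 2-orbit
  -- contributes 1. No cancellation can occur.
  have hterm : ∀ τ : Equiv.Perm {x // x ∈ S},
      ((Equiv.Perm.sign τ : ℤ) : ℂ) *
        ∏ i, φ.adjMatrix.submatrix (Subtype.val : {x // x ∈ S} → V) Subtype.val i (τ i) =
      if ∀ i : {x // x ∈ S}, G.Adj i (τ i) then (-1) ^ (S.card / 2) else 0 := by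
    intro τ
    split_ifs with h
    · have h1 : ∏ i, φ.adjMatrix.submatrix (Subtype.val : {x // x ∈ S} → V) Subtype.val i (τ i) =
          1 := by
        refine Finset.prod_involution (fun i _ => τ i) ?_ ?_ (by simp) ?_
        · intro i _
          rw [hinv τ h i]
          exact adjMatrix_mul_symm φ (h i)
        · intro i _ _ heq
          exact (h i).ne (congrArg Subtype.val heq).symm
        · intro i _
          exact hinv τ h i
      have h2 : τ ^ 2 = 1 := by
        ext i
        rw [pow_two, Equiv.Perm.mul_apply, hinv τ h i]
        rfl
      have h3 : Fintype.card (Function.fixedPoints τ) = 0 := by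
        rw [Fintype.card_eq_zero_iff]
        exact ⟨fun i => (h i.1).ne (congrArg Subtype.val i.2).symm⟩
      rw [h1, Equiv.Perm.sign_of_pow_two_eq_one h2, h3, Fintype.card_coe]
      simp
    · push Not at h
      obtain ⟨i, hi⟩ := h
      have h0 : φ.adjMatrix.submatrix (Subtype.val : {x // x ∈ S} → V) Subtype.val i (τ i) = 0 := by
        by_contra h0
        exact hi ((adjMatrix_ne_zero_iff φ).1 h0)
      rw [Finset.prod_eq_zero (f := fun i =>
        φ.adjMatrix.submatrix (Subtype.val : {x // x ∈ S} → V) Subtype.val i (τ i))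
        (Finset.mem_univ i) h0, mul_zero]
  rw [det_eq_sum, Finset.sum_congr rfl fun τ _ => hterm τ, ← Finset.sum_filter, Finset.sum_const,
    nsmul_eq_mul]
  refine mul_ne_zero ?_ (pow_ne_zero _ (by norm_num))
  rw [Nat.cast_ne_zero, ← Nat.pos_iff_ne_zero, Finset.card_pos]
  exact ⟨τ₀, by simpa using hτ₀⟩

open Classical in
/-- The adjacency matrix without the edges leaving the cycles. -/
noncomputable def cycleBlockMatrix : Matrix V V ℂ :=
  Matrix.of fun x y =>
    if (∃ C ∈ cycleSubgraphs G, x ∈ C.verts ∧ y ∈ C.verts) ∨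
      (x ∉ cycleVertices G ∧ y ∉ cycleVertices G) then φ.adjMatrix x y else 0

/-- For S this large, a permutation giving a nonzero term has every cycle of G as an orbit, so it
preserves each cycle and the complement of O(G). The erased entries never occur in such a term. -/
theorem det_cycleBlockMatrix (hG : G.Connected) {S : Finset V}
    (hS : 2 * matchingNumber G + cyclomaticNumber G ≤ (S.card : ℤ)) :
    ((cycleBlockMatrix φ).submatrix (Subtype.val : {x // x ∈ S} → V) Subtype.val).det =
      (φ.adjMatrix.submatrix (Subtype.val : {x // x ∈ S} → V) Subtype.val).det := by
  refine det_congr ?_ ?_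
  · intro i j h
    simp only [Matrix.submatrix_apply] at h
    simp [cycleBlockMatrix, h]
  · intro τ hτ i
    obtain ⟨σ, hsupp, hσ, hστ⟩ := exists_extension τ fun i => (adjMatrix_ne_zero_iff φ).1 (hτ i)
    rw [← hsupp] at hS
    obtain ⟨-, hcyc⟩ := cycles_of_le_card_support hG hσ hS
    have hinv : ∀ C ∈ cycleSubgraphs G, σ i ∈ C.verts ↔ (i : V) ∈ C.verts := by
      intro C hC
      obtain ⟨s, hT, -⟩ := hcyc C hC
      rw [hT.verts]
      exact hT.isCycleOn.apply_mem_iff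
    simp only [Matrix.submatrix_apply, cycleBlockMatrix, Matrix.of_apply, ← hστ]
    rw [if_pos]
    by_cases hO : (i : V) ∈ cycleVertices G
    · obtain ⟨C, hC, hi⟩ := mem_cycleVertices.1 hO
      exact Or.inl ⟨C, hC, hi, (hinv C hC).2 hi⟩
    · refine Or.inr ⟨hO, fun h => hO ?_⟩
      obtain ⟨C, hC, hi⟩ := mem_cycleVertices.1 h
      exact mem_cycleVertices.2 ⟨C, hC, (hinv C hC).1 hi⟩

theorem cycleBlockMatrix_apply_of_mem
    (hd : (cycleSubgraphs G).PairwiseDisjoint SimpleGraph.Subgraph.verts) {C : G.Subgraph}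
    (hC : C ∈ cycleSubgraphs G) {x y : V} [Decidable (x ∈ C.verts ∧ y ∈ C.verts)]
    (h : x ∈ C.verts ∨ y ∈ C.verts) :
    cycleBlockMatrix φ x y = if x ∈ C.verts ∧ y ∈ C.verts then φ.adjMatrix x y else 0 := by
  classical
  rw [cycleBlockMatrix, Matrix.of_apply]
  refine if_congr ⟨?_, fun h => Or.inl ⟨C, hC, h⟩⟩ rfl rfl
  rintro (⟨D, hD, hx, hy⟩ | ⟨hx, hy⟩)
  · have : C = D := by
      by_contra hne
      have := Set.disjoint_left.1 (hd hC hD hne)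
      rcases h with h | h
      exacts [this h hx, this h hy]
    subst this
    exact ⟨hx, hy⟩
  · rcases h with h | h
    · exact absurd (mem_cycleVertices.2 ⟨C, hC, h⟩) hx
    · exact absurd (mem_cycleVertices.2 ⟨C, hC, h⟩) hy

/-- Row sums of the block matrix over a set containing a cycle. -/
theorem sum_cycleBlockMatrix
    (hd : (cycleSubgraphs G).PairwiseDisjoint SimpleGraph.Subgraph.verts) {C : G.Subgraph}
    (hC : C ∈ cycleSubgraphs G) {s S : Finset V} (hs : C.verts = s) (hsS : s ⊆ S) {x : V}
    (hx : x ∈ s) (f : V → ℂ) :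
    ∑ y ∈ S, cycleBlockMatrix φ x y * f y = ∑ y ∈ s, φ.adjMatrix x y * f y := by
  classical
  have hxC : x ∈ C.verts := by rw [hs]; exact hx
  symm
  rw [← Finset.sum_subset hsS]
  · refine Finset.sum_congr rfl fun y hy => ?_
    have hyC : y ∈ C.verts := by rw [hs]; exact hy
    rw [cycleBlockMatrix_apply_of_mem φ hd hC (Or.inl hxC), if_pos ⟨hxC, hyC⟩]
  · intro y _ hy
    have hyC : y ∉ C.verts := by rw [hs]; exact hy
    rw [cycleBlockMatrix_apply_of_mem φ hd hC (Or.inl hxC), if_neg fun h => hyC h.2, zero_mul]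

/-- A large nonzero principal minor forces the minors of the cycles to be nonzero. -/
theorem det_cycle_ne_zero_of_det_ne_zero (hG : G.Connected)
    (hd : (cycleSubgraphs G).PairwiseDisjoint SimpleGraph.Subgraph.verts) {S s : Finset V}
    (hS : 2 * matchingNumber G + cyclomaticNumber G ≤ (S.card : ℤ))
    (hdet : (φ.adjMatrix.submatrix (Subtype.val : {x // x ∈ S} → V) Subtype.val).det ≠ 0)
    {C : G.Subgraph} (hC : C ∈ cycleSubgraphs G) (hs : C.verts = s) (hsS : s ⊆ S) :
    (φ.adjMatrix.submatrix (Subtype.val : {x // x ∈ s} → V) Subtype.val).det ≠ 0 := by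
  rw [← det_cycleBlockMatrix φ hG hS, det_minor_ne_zero_iff] at hdet
  rw [det_minor_ne_zero_iff]
  intro f hf x hx
  -- A kernel vector of the cycle block, extended by zero, is a kernel vector of the block matrix on
  -- S.
  have := hdet (fun y => if y ∈ s then f y else 0) ?_ x (hsS hx)
  · simpa [hx] using this
  intro v hv
  by_cases hvs : v ∈ s
  · rw [sum_cycleBlockMatrix φ hd hC hs hsS hvs, ← hf v hvs]
    exact Finset.sum_congr rfl fun y hy => by rw [if_pos hy]
  · refine Finset.sum_eq_zero fun y hy => ?_
    classical
    split_ifs with hys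
    · have hyC : y ∈ C.verts := by rw [hs]; exact hys
      have hvC : v ∉ C.verts := by rw [hs]; exact hvs
      rw [cycleBlockMatrix_apply_of_mem φ hd hC (Or.inr hyC), if_neg fun h => hvC h.1, zero_mul]
    · rw [mul_zero]

/-- The principal minor of the cycles together with a matched set is nonzero if its diagonal
blocks are nonsingular. -/
theorem det_ne_zero_of_blocks (hG : G.Connected)
    (hd : (cycleSubgraphs G).PairwiseDisjoint SimpleGraph.Subgraph.verts) {S T : Finset V}
    (hS : 2 * matchingNumber G + cyclomaticNumber G ≤ (S.card : ℤ))
    (hST : ∀ x, x ∈ S ↔ x ∈ cycleVertices G ∨ x ∈ T) (hT : ∀ x ∈ T, x ∉ cycleVertices G)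
    (hdetT : (φ.adjMatrix.submatrix (Subtype.val : {x // x ∈ T} → V) Subtype.val).det ≠ 0)
    (hcyc : ∀ C ∈ cycleSubgraphs G, ∃ s : Finset V, C.verts = s ∧
      (φ.adjMatrix.submatrix (Subtype.val : {x // x ∈ s} → V) Subtype.val).det ≠ 0) :
    (φ.adjMatrix.submatrix (Subtype.val : {x // x ∈ S} → V) Subtype.val).det ≠ 0 := by
  rw [← det_cycleBlockMatrix φ hG hS, det_minor_ne_zero_iff]
  intro f hf x hx
  rcases (hST x).1 hx with hxO | hxT
  · obtain ⟨C, hC, hxC⟩ := mem_cycleVertices.1 hxO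
    obtain ⟨s, hs, hdet⟩ := hcyc C hC
    have hsS : s ⊆ S := by
      intro y hy
      refine (hST y).2 (Or.inl (mem_cycleVertices.2 ⟨C, hC, ?_⟩))
      rw [hs]; exact hy
    rw [hs] at hxC
    refine det_minor_ne_zero_iff.1 hdet f (fun v hv => ?_) x hxC
    rw [← sum_cycleBlockMatrix φ hd hC hs hsS hv]
    exact hf v (hsS hv)
  · refine det_minor_ne_zero_iff.1 hdetT f (fun v hv => ?_) x hxT
    have hTS : T ⊆ S := fun y hy => (hST y).2 (Or.inr hy)
    rw [← hf v (hTS hv), ← Finset.sum_subset hTS]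
    · refine Finset.sum_congr rfl fun y hy => ?_
      rw [cycleBlockMatrix, Matrix.of_apply, if_pos (Or.inr ⟨hT v hv, hT y hy⟩)]
    · intro y hyS hyT
      have hyO := ((hST y).1 hyS).resolve_right hyT
      rw [cycleBlockMatrix, Matrix.of_apply, if_neg, zero_mul]
      rintro (⟨C, hC, h, -⟩ | ⟨-, h⟩)
      · exact hT v hv (mem_cycleVertices.2 ⟨C, hC, h⟩)
      · exact h hyO

/-- The part of the support outside the cycles is perfectly matched. -/
theorem card_support_le_of_invariant {σ : Equiv.Perm V} (hσ : ∀ x ∈ σ.support, G.Adj x (σ x))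
    (hinv : ∀ x, σ x ∈ cycleVertices G ↔ x ∈ cycleVertices G) :
    σ.support.card ≤ (cycleVertices G).ncard +
      2 * matchingNumber (G.induce (cycleVertices G)ᶜ) := by
  classical
  let H := G.induce (cycleVertices G)ᶜ
  have hH : H.IsAcyclic := by
    intro v w hw
    have hc : (w.map (SimpleGraph.Embedding.induce (cycleVertices G)ᶜ).toHom).IsCycle :=
      (SimpleGraph.Walk.isCycle_map_iff_of_injective Subtype.val_injective).2 hw
    exact v.2 (mem_cycleVertices.2 ⟨_, ⟨_, _, hc, rfl⟩,
      SimpleGraph.Walk.start_mem_verts_toSubgraph _⟩)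
  have hmem : ∀ x, σ x ∈ (cycleVertices G)ᶜ ↔ x ∈ (cycleVertices G)ᶜ := fun x =>
    not_congr (hinv x)
  let τ : Equiv.Perm ((cycleVertices G)ᶜ : Set V) := σ.subtypePerm hmem
  have hτ : ∀ x ∈ τ.support, H.Adj x (τ x) := by
    intro x hx
    refine hσ x (Equiv.Perm.mem_support.2 fun h => Equiv.Perm.mem_support.1 hx (Subtype.ext h))
  obtain ⟨n, C, s, hC, hT, hodd, hd, hle⟩ := exists_odd_trajectories hτ
  have hle' : τ.support.card ≤ 2 * matchingNumber (G.induce (cycleVertices G)ᶜ) + n := hle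
  -- An odd orbit would be a cycle in the forest G - O(G).
  have hn : n = 0 := by
    by_contra hn
    exact not_isAcyclic_of_forall_mem (hC ⟨0, Nat.pos_of_ne_zero hn⟩)
      (fun e he => (C _).edgeSet_subset he) hH
  have hsub : (σ.support : Set V) ⊆ cycleVertices G ∪
      ((τ.support.map (Function.Embedding.subtype _) : Finset V) : Set V) := by
    intro x hx
    by_cases hO : x ∈ cycleVertices G
    · exact Or.inl hO
    · refine Or.inr ?_
      simp only [Finset.coe_map, Set.mem_image, Finset.mem_coe]
      refine ⟨⟨x, hO⟩, Equiv.Perm.mem_support.2 fun h => ?_, rfl⟩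
      exact Equiv.Perm.mem_support.1 hx (congrArg Subtype.val h)
  have h1 := (Set.ncard_le_ncard hsub (Set.toFinite _)).trans (Set.ncard_union_le _ _)
  rw [Set.ncard_coe_finset, Set.ncard_coe_finset, Finset.card_map] at h1
  omega

/-- The upper bound for the rank. -/
theorem rank_le (hG : G.Connected) :
    (φ.rank : ℤ) ≤ 2 * matchingNumber G + cyclomaticNumber G := by
  obtain ⟨S, hS, hdet⟩ := exists_principal_minor (isHermitian_adjMatrix φ)
  obtain ⟨τ, hτ⟩ := exists_perm_of_det_ne_zero hdet
  obtain ⟨σ, hsupp, hσ, -⟩ := exists_extension τ fun i => (adjMatrix_ne_zero_iff φ).1 (hτ i)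
  have := card_support_le hG hσ
  rwa [hsupp, hS] at this

theorem conditions_of_rank_eq (hG : G.Connected)
    (h : (φ.rank : ℤ) = 2 * (matchingNumber G : ℤ) + cyclomaticNumber G) :
    (cycleSubgraphs G).PairwiseDisjoint SimpleGraph.Subgraph.verts ∧
      (∀ (u : V) (w : G.Walk u u), w.IsCycle →
        Complex.re (φ.walkGain w : ℂ) ≠ 0 ∧ Odd w.length) ∧
      matchingNumber (contractCycles G) = matchingNumber (G.induce (cycleVertices G)ᶜ) := by
  obtain ⟨S, hS, hdet⟩ := exists_principal_minor (isHermitian_adjMatrix φ)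
  have hS' : 2 * matchingNumber G + cyclomaticNumber G ≤ (S.card : ℤ) := by
    rw [hS, ← h, UnitGain.rank]
  obtain ⟨τ, hτ⟩ := exists_perm_of_det_ne_zero hdet
  obtain ⟨σ, hsupp, hσ, -⟩ := exists_extension τ fun i => (adjMatrix_ne_zero_iff φ).1 (hτ i)
  obtain ⟨hd, hcyc⟩ := cycles_of_le_card_support hG hσ (by rwa [hsupp])
  refine ⟨hd, ?_, ?_⟩
  · intro u w hw
    have hC : w.toSubgraph ∈ cycleSubgraphs G := ⟨u, w, hw, rfl⟩
    obtain ⟨s, hT, hodd⟩ := hcyc _ hC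
    -- The permutation σ may run around the cycle against w; ρ follows w, so its product is the gain
    -- of w.
    obtain ⟨ρ, t, hρ, hcard, hρw, htw⟩ := exists_isTrajectory_of_isCycle hw
    obtain rfl : s = t := by
      have := hT.verts.symm.trans hρ.verts
      exact_mod_cast this
    refine ⟨?_, hcard ▸ hodd⟩
    rw [walkGain_eq_prod φ hw htw hρw]
    refine (det_cycle_ne_zero_iff φ hρ hodd
      fun x hx y hy hxy => adj_of_mem_cycle hd hC hx hy hxy).1 ?_
    refine det_cycle_ne_zero_of_det_ne_zero φ hG hd hS' hdet hC hρ.verts ?_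
    intro x hx
    rw [← hsupp, Equiv.Perm.mem_support]
    exact (hT.adj x hx).ne'
  -- With q the sum of ⌊|C|/2⌋ over the cycles: 2m(T_G) + 2q + c ≤ 2m(G) + c ≤ |S| ≤ |O(G)| + 2m(G -
  -- O(G)), and |O(G)| = 2q + c.
  · refine le_antisymm ?_ matchingNumber_induce_le
    have : Fintype (cycleSubgraphs G) := Fintype.ofFinite _
    choose s hT hodd using fun C : cycleSubgraphs G => hcyc C C.2
    have h1 := matchingNumber_contractCycles_add_le hd hT hodd
    have h2 := ncard_cycleVertices hd hT hodd
    have h3 := card_cycleSubgraphs hG hd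
    rw [Nat.card_eq_fintype_card] at h3
    have h4 := card_support_le_of_invariant hσ fun x => by
      rw [mem_cycleVertices_iff hT, mem_cycleVertices_iff hT]
      refine exists_congr fun C => ?_
      exact_mod_cast (hT C).isCycleOn.apply_mem_iff (x := x)
    rw [hsupp] at h4
    omega

theorem rank_eq_of_conditions (hG : G.Connected)
    (hd : (cycleSubgraphs G).PairwiseDisjoint SimpleGraph.Subgraph.verts)
    (hre : ∀ (u : V) (w : G.Walk u u), w.IsCycle →
      Complex.re (φ.walkGain w : ℂ) ≠ 0 ∧ Odd w.length)
    (hm : matchingNumber (contractCycles G) = matchingNumber (G.induce (cycleVertices G)ᶜ)) :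
    (φ.rank : ℤ) = 2 * (matchingNumber G : ℤ) + cyclomaticNumber G := by
  classical
  have : Fintype (cycleSubgraphs G) := Fintype.ofFinite _
  have hcyc : ∀ C : cycleSubgraphs G, ∃ (σ : Equiv.Perm V) (s : Finset V),
      IsTrajectory (C : G.Subgraph) σ s ∧ Odd s.card ∧
      (φ.adjMatrix.submatrix (Subtype.val : {x // x ∈ s} → V) Subtype.val).det ≠ 0 := by
    rintro ⟨C, hC⟩
    obtain ⟨u, w, hw, rfl⟩ := id hC
    obtain ⟨ρ, t, hρ, hcard, hρw, htw⟩ := exists_isTrajectory_of_isCycle hw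
    obtain ⟨h1, h2⟩ := hre u w hw
    rw [← hcard] at h2
    refine ⟨ρ, t, hρ, h2, (det_cycle_ne_zero_iff φ hρ h2
      fun x hx y hy hxy => adj_of_mem_cycle hd hC hx hy hxy).2 ?_⟩
    rwa [walkGain_eq_prod φ hw htw hρw] at h1
  choose σ s hT hodd hdet using hcyc
  obtain ⟨e, he, heO⟩ := exists_isEdgeMatching_avoiding G
  set T : Finset V := Finset.univ.filter fun x => ∃ i, x ∈ e i with hTdef
  have hTmem : ∀ x, x ∈ T ↔ ∃ i, x ∈ e i := fun x => by simp [T]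
  have hTO : ∀ x ∈ T, x ∉ cycleVertices G := fun x hx => by
    obtain ⟨i, hi⟩ := (hTmem x).1 hx
    exact heO i x hi
  obtain ⟨τ, hτ⟩ := he.exists_perm hTmem
  have hTcard : T.card = 2 * matchingNumber (G.induce (cycleVertices G)ᶜ) := by
    have := he.ncard_covered
    rw [Fintype.card_fin] at this
    rw [← this, ← Set.ncard_coe_finset]
    congr 1
    ext x
    exact hTmem x
  set O : Finset V := (cycleVertices G).toFinset
  have hOT : Disjoint O T :=
    Finset.disjoint_left.2 fun x hx hxT => hTO x hxT (by simpa [O] using hx)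
  have hOcard : O.card = (cycleVertices G).ncard := by
    rw [Set.ncard_eq_toFinset_card']
  have h1 := matchingNumber_le_of_eq hd hT hm
  have h2 := ncard_cycleVertices hd hT hodd
  have h3 := card_cycleSubgraphs hG hd
  rw [Nat.card_eq_fintype_card] at h3
  -- With q the sum of ⌊|C|/2⌋, |O| + |T| = 2q + c + 2m(G - O(G)), and m(G) ≤ m(T_G) + q by `h1`.
  have hS : 2 * matchingNumber G + cyclomaticNumber G ≤ ((O ∪ T).card : ℤ) := by
    rw [Finset.card_union_of_disjoint hOT, hOcard, hTcard]
    omega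
  have hdetS := det_ne_zero_of_blocks φ hG hd hS (T := T) (by simp [O]) hTO
    (det_matched_ne_zero φ hTO τ hτ)
    fun C hC => ⟨s ⟨C, hC⟩, (hT ⟨C, hC⟩).verts, hdet ⟨C, hC⟩⟩
  have h4 := card_le_rank_of_det_ne_zero hdetS
  refine le_antisymm (rank_le φ hG) ?_
  rw [UnitGain.rank]
  omega

end GainGraph

theorem theorem1p12 {V : Type*} [Fintype V] (G : SimpleGraph V) (hG : G.Connected)
    (φ : UnitGain G) :
    (φ.rank : ℤ) = 2 * (GainGraph.matchingNumber G : ℤ) + GainGraph.cyclomaticNumber G ↔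
      (GainGraph.cycleSubgraphs G).PairwiseDisjoint SimpleGraph.Subgraph.verts ∧
      (∀ (u : V) (w : G.Walk u u), w.IsCycle →
        Complex.re (φ.walkGain w : ℂ) ≠ 0 ∧ Odd w.length) ∧
      GainGraph.matchingNumber (GainGraph.contractCycles G) =
        GainGraph.matchingNumber (G.induce (GainGraph.cycleVertices G)ᶜ) := by
  classical
  exact ⟨GainGraph.conditions_of_rank_eq φ hG,
    fun ⟨hd, hre, hm⟩ => GainGraph.rank_eq_of_conditions φ hG hd hre hm⟩
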